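/- Let $d\ge 2$, let $\mathbb S^d\subset\mathbb R^{d+1}$ be the unit sphere with normalized surface measure $\sigma_d$, and for each $\ell\ge 0$ let $Y_{\ell,k}$, $k=1,\dots,Z(d,\ell)$, be $L_2(\sigma_d)$-orthonormal real spherical harmonics of degree $\ell$, where $Z(d,\ell)=(2\ell+d-1)\,\Gamma(\ell+d-1)/(\Gamma(d)\,\Gamma(\ell+1))$. Let $P_\ell^{(d)}$ be the Gegenbauer polynomial of degree $\ell$, orthogonal on $[-1,1]$ with respect to the weight $(1-t^2)^{d/2-1}$ and normalized by $P^{(d)}_\ell(1)=1$. Put $\lambda_\ell=\ell(\ell+d-1)$ and $\widehat f_{\ell,k}=\int_{\mathbb S^d} f\,Y_{\ell,k}\,d\sigma_d$. Let $s>d/2$, and let $\mathbb H^s(\mathbb S^d)$ be the space of all $f\in L_2(\mathbb S^d)$ with $\sum_{\ell\ge0}\sum_{k}(1+\lambda_\ell)^s|\widehat f_{\ell,k}|^2<\infty$. Let $(a_\ell)_{\ell\ge 0}$ be a sequence of positive reals for which there are constants $c_1,c_2>0$ with $c_1(1+\lambda_\ell)^{-s}\le a_\ell\le c_2(1+\lambda_\ell)^{-s}$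 for all $\ell$, and equip $\mathbb H^s(\mathbb S^d)$ with the norm $$\|f\|_{\mathbb H^s}=\Big(\sum_{\ell=0}^\infty\sum_{k=1}^{Z(d,\ell)}\frac1{a_\ell}|\widehat f_{\ell,k}|^2\Big)^{1/2}.$$ Then every element of $\mathbb H^s(\mathbb S^d)$ has exactly one continuous representative; elements of $\mathbb H^s(\mathbb S^d)$ are evaluated at points through it. The series $$\mathcal K(t)=\sum_{\ell=1}^\infty a_\ell\,Z(d,\ell)\,P_\ell^{(d)}(t)$$ converges for every $t\in[-1,1]$. For all $N\ge1$ and all points $x_1,\dots,x_N\in\mathbb S^d$ (not necessarily distinct), the worst-case error $$\mathrm{wce}=\sup\Big\{\Big|\frac1N\sum_{j=1}^N f(x_j)-\int_{\mathbb S^d}f\,d\sigma_d\Big| : f\in\mathbb H^s(\mathbb S^d),\ \|f\|_{\mathbb H^s}\le1\Big\}$$ is finite and $$\mathrm{wce}=\Big(\frac1{N^2}\sum_{j=1}^N\sum_{i=1}^N\mathcal K(x_j\cdot x_i)\Big)^{1/2}=\Big(\sum_{\ell=1}^\infty\sum_{k=1}^{Z(d,\ell)}a_\ell\Big|\frac1N\sum_{j=1}^N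 Y_{\ell,k}(x_j)\Big|^2\Big)^{1/2},$$ where the double sum of $\mathcal K$ is nonnegative and the last series converges. -/

import Mathlib

open MeasureTheory

/-! ### The sphere and its normalized surface measure -/

/-- The unit sphere `S^d` in `ℝ^(d+1)`. -/
abbrev Sph (d : ℕ) : Type :=
  Metric.sphere (0 : EuclideanSpace ℝ (Fin (d + 1))) 1

/-- The normalized surface measure `σ_d` on `S^d`. -/
noncomputable def surfaceMeasure (d : ℕ) : Measure (Sph d) :=
  ((volume : Measure (EuclideanSpace ℝ (Fin (d + 1)))).toSphere Set.univ)⁻¹ •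
    (volume : Measure (EuclideanSpace ℝ (Fin (d + 1)))).toSphere

instance surfaceMeasure_isProbabilityMeasure (d : ℕ) :
    IsProbabilityMeasure (surfaceMeasure d) := by
  constructor
  have h0 : (volume : Measure (EuclideanSpace ℝ (Fin (d + 1)))).toSphere Set.univ ≠ 0 := by
    rw [Ne, Measure.measure_univ_eq_zero]
    exact Measure.toSphere_ne_zero _
  simp only [surfaceMeasure, Measure.smul_apply, smul_eq_mul]
  exact ENNReal.inv_mul_cancel h0 (measure_ne_top _ _)

/-! ### Spherical harmonics -/

/-- The dimension `Z(d, n)` of the space of spherical harmonics of degree `n` on `S^d`, `d ≥ 2`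
(the division is exact, see `harmonicDim_eq`). -/
def harmonicDim (d n : ℕ) : ℕ :=
  (2 * n + d - 1) * (n + d - 2).factorial / ((d - 1).factorial * n.factorial)

/-- `Z(d, n) = (2n + d - 1) Γ(n + d - 1) / (Γ(d) Γ(n + 1))`. -/
theorem harmonicDim_eq (d n : ℕ) (hd : 2 ≤ d) :
    (harmonicDim d n : ℝ) =
      (2 * n + d - 1) * (Real.Gamma (n + d - 1) / (Real.Gamma d * Real.Gamma (n + 1))) := by
  obtain ⟨e, rfl⟩ := Nat.exists_eq_add_of_le hd
  have hdvd : (e + 1).factorial * n.factorial ∣ (2 * n + e + 1) * (n + e).factorial := by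
    have h1 : (e + 1).factorial * n.factorial ∣ (n + e + 1) * (n + e).factorial := by
      have := Nat.factorial_mul_factorial_dvd_factorial_add (e + 1) n
      rwa [show e + 1 + n = (n + e) + 1 by ring, Nat.factorial_succ] at this
    have h2 : (e + 1).factorial * n.factorial ∣ n * (n + e).factorial := by
      cases n with
      | zero => simp
      | succ m =>
        have := Nat.factorial_mul_factorial_dvd_factorial_add (e + 1) m
        rw [show e + 1 + m = m + 1 + e by ring] at this
        rw [Nat.factorial_succ m, show (e + 1).factorial * ((m + 1) * m.factorial)
          = (m + 1) * ((e + 1).factorial * m.factorial) by ring]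
        exact Nat.mul_dvd_mul_left _ this
    have := Nat.dvd_add h1 h2
    rwa [← add_mul, show n + e + 1 + n = 2 * n + e + 1 by ring] at this
  have e1 : Real.Gamma ((n : ℝ) + ((2 + e : ℕ) : ℝ) - 1) = (n + e).factorial := by
    rw [← Real.Gamma_nat_eq_factorial]; congr 1; push_cast; ring
  have e2 : Real.Gamma ((2 + e : ℕ) : ℝ) = (e + 1).factorial := by
    rw [← Real.Gamma_nat_eq_factorial]; congr 1; push_cast; ring
  have e3 : harmonicDim (2 + e) n =
      (2 * n + e + 1) * (n + e).factorial / ((e + 1).factorial * n.factorial) := by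
    unfold harmonicDim
    rw [show 2 * n + (2 + e) - 1 = 2 * n + e + 1 by omega,
      show n + (2 + e) - 2 = n + e by omega, show 2 + e - 1 = e + 1 by omega]
  rw [e1, e2, Real.Gamma_nat_eq_factorial, e3, Nat.cast_div hdvd (by positivity)]
  push_cast
  ring

/-- `f` is a (real) spherical harmonic of degree `ℓ`: the restriction to the sphere of a
homogeneous harmonic polynomial of degree `ℓ` in `d + 1` variables. -/
def IsSphericalHarmonic {d : ℕ} (ℓ : ℕ) (f : C(Sph d, ℝ)) : Prop :=
  ∃ p : MvPolynomial (Fin (d + 1)) ℝ,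
    p.IsHomogeneous ℓ ∧
    ∑ i, MvPolynomial.pderiv i (MvPolynomial.pderiv i p) = 0 ∧
    ∀ x : Sph d, f x = MvPolynomial.eval (fun i => (x : EuclideanSpace ℝ (Fin (d + 1))) i) p

/-- For every degree `ℓ`, the functions `Y ℓ k`, `k = 1, …, Z(d, ℓ)`, are `L₂(σ_d)`-orthonormal
spherical harmonics of degree `ℓ`. -/
def IsHarmonicSystem {d : ℕ} (Y : (ℓ : ℕ) → Fin (harmonicDim d ℓ) → C(Sph d, ℝ)) : Prop :=
  ∀ ℓ, (∀ k, IsSphericalHarmonic ℓ (Y ℓ k)) ∧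
    ∀ k k', ∫ x, Y ℓ k x * Y ℓ k' x ∂(surfaceMeasure d) = if k = k' then 1 else 0

/-! ### Normalized Gegenbauer (Legendre) polynomials -/

/-- The normalized Gegenbauer polynomial `P_ℓ^{(d)}`, through its three-term recurrence. It is the
polynomial of degree `ℓ`, orthogonal on `[-1, 1]` with respect to the weight
`(1 - t²)^(d/2 - 1)` to those of other degrees, with value `1` at `1`:
see `gegenbauerP_natDegree`, `gegenbauerP_orthogonal` and `gegenbauerP_eval_one`. -/
noncomputable def gegenbauerP (d : ℕ) : ℕ → Polynomial ℝ
  | 0 => 1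
  | 1 => Polynomial.X
  | n + 2 => Polynomial.C (((n : ℝ) + d)⁻¹) *
      (Polynomial.C (2 * (n : ℝ) + d + 1) * Polynomial.X * gegenbauerP d (n + 1)
        - Polynomial.C ((n : ℝ) + 1) * gegenbauerP d n)

theorem gegenbauerP_rec (d n : ℕ) (hd : 2 ≤ d) :
    Polynomial.C ((n : ℝ) + d) * gegenbauerP d (n + 2) =
      Polynomial.C (2 * (n : ℝ) + d + 1) * Polynomial.X * gegenbauerP d (n + 1)
        - Polynomial.C ((n : ℝ) + 1) * gegenbauerP d n := by
  have h : ((n : ℝ) + d) ≠ 0 := by positivity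
  rw [gegenbauerP, ← mul_assoc, ← Polynomial.C_mul, mul_inv_cancel₀ h, Polynomial.C_1, one_mul]

theorem gegenbauerP_eval_one (d ℓ : ℕ) (hd : 2 ≤ d) : (gegenbauerP d ℓ).eval 1 = 1 := by
  induction ℓ using Nat.twoStepInduction with
  | zero => simp [gegenbauerP]
  | one => simp [gegenbauerP]
  | more n h0 h1 =>
    have h : ((n : ℝ) + d) ≠ 0 := by positivity
    have := congrArg (Polynomial.eval 1) (gegenbauerP_rec d n hd)
    simp only [Polynomial.eval_mul, Polynomial.eval_sub, Polynomial.eval_C, Polynomial.eval_X,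
      h0, h1] at this
    apply mul_left_cancel₀ h
    rw [this]; ring

theorem gegenbauerP_natDegree (d ℓ : ℕ) (hd : 2 ≤ d) : (gegenbauerP d ℓ).natDegree = ℓ := by
  have key : ∀ n, (gegenbauerP d n).natDegree ≤ n ∧ 0 < (gegenbauerP d n).coeff n := by
    intro n
    induction n using Nat.twoStepInduction with
    | zero => simp [gegenbauerP]
    | one => simp [gegenbauerP]
    | more n h0 h1 =>
      have h : (0 : ℝ) < (n : ℝ) + d := by positivity
      have hz : (gegenbauerP d n).coeff (n + 2) = 0 :=
        Polynomial.coeff_eq_zero_of_natDegree_lt (by omega)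
      constructor
      · rw [gegenbauerP, mul_assoc]
        refine (Polynomial.natDegree_C_mul_le _ _).trans
          ((Polynomial.natDegree_sub_le _ _).trans (max_le ?_ ?_))
        · refine (Polynomial.natDegree_C_mul_le _ _).trans
            (Polynomial.natDegree_mul_le.trans ?_)
          have := h1.1
          simp only [Polynomial.natDegree_X]
          omega
        · refine (Polynomial.natDegree_C_mul_le _ _).trans ?_
          have := h0.1
          omega
      · rw [gegenbauerP, mul_assoc]
        simp only [Polynomial.coeff_C_mul, Polynomial.coeff_sub, hz, mul_zero, sub_zero,
          Polynomial.coeff_X_mul]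
        have := h1.2
        positivity
  exact le_antisymm (key ℓ).1 (Polynomial.le_natDegree_of_ne_zero (key ℓ).2.ne')

/-- `(1 - t²) P_{n+1}' = (n+1) (P_n - t P_{n+1})` and
`(1 - t²) P_n' = (n+d-1) (t P_n - P_{n+1})`. -/
theorem gegenbauerP_deriv (d n : ℕ) (hd : 2 ≤ d) :
    (1 - Polynomial.X ^ 2) * (gegenbauerP d (n + 1)).derivative =
      Polynomial.C ((n : ℝ) + 1) * (gegenbauerP d n - Polynomial.X * gegenbauerP d (n + 1)) ∧
    (1 - Polynomial.X ^ 2) * (gegenbauerP d n).derivative =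
      Polynomial.C ((n : ℝ) + d - 1) *
        (Polynomial.X * gegenbauerP d n - gegenbauerP d (n + 1)) := by
  induction n with
  | zero => constructor <;> simp [gegenbauerP] ; ring
  | succ n ih =>
    obtain ⟨ih1, ih2⟩ := ih
    have hr := gegenbauerP_rec d n hd
    have h : ((n : ℝ) + d) ≠ 0 := by positivity
    have hC : (Polynomial.C ((n : ℝ) + d)) ≠ 0 :=
      Polynomial.C_ne_zero.2 h
    have hB : (1 - Polynomial.X ^ 2) * (gegenbauerP d (n + 1)).derivative =
        Polynomial.C (((n + 1 : ℕ) : ℝ) + d - 1) *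
        (Polynomial.X * gegenbauerP d (n + 1) - gegenbauerP d (n + 1 + 1)) := by
      rw [ih1]
      simp only [map_add, map_mul, map_sub, Nat.cast_add, Nat.cast_one, map_one,
        map_natCast, map_ofNat] at hr ⊢
      linear_combination hr
    refine ⟨?_, hB⟩
    apply mul_left_cancel₀ hC
    have hr' := congrArg Polynomial.derivative hr
    simp only [Polynomial.derivative_mul, Polynomial.derivative_sub, Polynomial.derivative_C,
      Polynomial.derivative_X, zero_mul, zero_add, mul_one] at hr'
    rw [show n + 1 + 1 = n + 2 from rfl]
    simp only [map_add, map_mul, map_sub, Nat.cast_add, Nat.cast_one, map_one,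
      map_natCast, map_ofNat] at hr hr' ih1 ih2 ⊢
    linear_combination (1 - Polynomial.X ^ 2) * hr' +
      (2 * (n : Polynomial ℝ) + d + 1) * Polynomial.X * ih1 - ((n : Polynomial ℝ) + 1) * ih2
      + ((n : Polynomial ℝ) + 2) * Polynomial.X * hr

/-- The differential equation `(1 - t²) P'' - d t P' + n (n + d - 1) P = 0`. -/
theorem gegenbauerP_ode (d n : ℕ) (hd : 2 ≤ d) :
    (1 - Polynomial.X ^ 2) * (gegenbauerP d n).derivative.derivative
      - Polynomial.C (d : ℝ) * Polynomial.X * (gegenbauerP d n).derivative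
      + Polynomial.C ((n : ℝ) * (n + d - 1)) * gegenbauerP d n = 0 := by
  cases n with
  | zero => simp [gegenbauerP]
  | succ n =>
    have hne : (1 - Polynomial.X ^ 2 : Polynomial ℝ) ≠ 0 := by
      intro h
      have := congrArg (Polynomial.eval 0) h
      simp at this
    apply mul_left_cancel₀ hne
    obtain ⟨h1, h2⟩ := gegenbauerP_deriv d n hd
    have h1' := congrArg Polynomial.derivative h1
    simp only [Polynomial.derivative_mul, Polynomial.derivative_sub, Polynomial.derivative_C,
      Polynomial.derivative_X, Polynomial.derivative_one, Polynomial.derivative_X_pow,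
      zero_mul, zero_add] at h1'
    simp only [map_add, map_mul, map_sub, Nat.cast_add, Nat.cast_one, map_one,
      map_natCast, Nat.add_one_sub_one, pow_one, Nat.cast_ofNat, map_ofNat] at h1 h1' h2 ⊢
    linear_combination (1 - Polynomial.X ^ 2) * h1' + ((n : Polynomial ℝ) + 1) * h2
      - (((n : Polynomial ℝ) + d - 1)) * Polynomial.X * h1

/-- Orthogonality on `[-1, 1]` with respect to the weight `(1 - t²)^(d/2 - 1)`. -/
theorem gegenbauerP_orthogonal (d m n : ℕ) (hd : 2 ≤ d) (hmn : m ≠ n) :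
    ∫ t in (-1 : ℝ)..1, (gegenbauerP d m).eval t * (gegenbauerP d n).eval t *
      (1 - t ^ 2) ^ ((d : ℝ) / 2 - 1) = 0 := by
  have hd' : (2 : ℝ) ≤ d := by exact_mod_cast hd
  set P := gegenbauerP d m with hP
  set Q := gegenbauerP d n with hQ
  set lm : ℝ := (m : ℝ) * (m + d - 1)
  set ln : ℝ := (n : ℝ) * (n + d - 1)
  have hl : ln - lm ≠ 0 := by
    have : ln - lm = ((n : ℝ) - m) * (n + m + d - 1) := by simp only [ln, lm]; ring
    rw [this]
    refine mul_ne_zero (sub_ne_zero.2 (by exact_mod_cast hmn.symm)) ?_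
    have : (0 : ℝ) ≤ n + m := by positivity
    linarith
  have hbase : Continuous fun t : ℝ => 1 - t ^ 2 := by fun_prop
  have hc1 : Continuous fun t : ℝ => (1 - t ^ 2) ^ ((d : ℝ) / 2) :=
    hbase.rpow_const fun t => Or.inr (by linarith)
  have hc2 : Continuous fun t : ℝ => (1 - t ^ 2) ^ ((d : ℝ) / 2 - 1) :=
    hbase.rpow_const fun t => Or.inr (by linarith)
  have hint := intervalIntegral.integral_eq_sub_of_hasDerivAt_of_le
    (a := (-1 : ℝ)) (b := 1) (by norm_num)
    (f := fun t => (1 - t ^ 2) ^ ((d : ℝ) / 2) *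
      (P.derivative.eval t * Q.eval t - P.eval t * Q.derivative.eval t))
    (f' := fun t => (ln - lm) * (P.eval t * Q.eval t * (1 - t ^ 2) ^ ((d : ℝ) / 2 - 1)))
    (by
      apply Continuous.continuousOn
      fun_prop)
    (by
      intro t ht
      have hpos : 0 < 1 - t ^ 2 := by nlinarith [ht.1, ht.2]
      have hb : HasDerivAt (fun t : ℝ => 1 - t ^ 2) (-(2 * t)) t := by
        simpa using ((hasDerivAt_id t).pow 2).const_sub 1
      have hw := hb.rpow_const (p := (d : ℝ) / 2) (Or.inl hpos.ne')
      have hW := ((P.derivative.hasDerivAt t).mul (Q.hasDerivAt t)).sub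
        ((P.hasDerivAt t).mul (Q.derivative.hasDerivAt t))
      have hsplit : (1 - t ^ 2) ^ ((d : ℝ) / 2) =
          (1 - t ^ 2) ^ ((d : ℝ) / 2 - 1) * (1 - t ^ 2) := by
        rw [← Real.rpow_add_one hpos.ne']; congr 1; ring
      have o1 := congrArg (Polynomial.eval t) (gegenbauerP_ode d m hd)
      have o2 := congrArg (Polynomial.eval t) (gegenbauerP_ode d n hd)
      simp only [Polynomial.eval_add, Polynomial.eval_sub, Polynomial.eval_mul,
        Polynomial.eval_C, Polynomial.eval_X, Polynomial.eval_one, Polynomial.eval_pow,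
        Polynomial.eval_zero, ← hP, ← hQ] at o1 o2
      refine (hw.mul hW).congr_deriv ?_
      simp only [Pi.sub_apply, Pi.mul_apply]
      rw [hsplit]
      simp only [ln, lm]
      linear_combination (1 - t ^ 2) ^ ((d : ℝ) / 2 - 1) * (Q.eval t * o1 - P.eval t * o2))
    (by
      apply Continuous.intervalIntegrable
      fun_prop)
  rw [intervalIntegral.integral_const_mul] at hint
  have hz : (0 : ℝ) ^ ((d : ℝ) / 2) = 0 := Real.zero_rpow (by linarith)
  simp only [one_pow, sub_self, hz, zero_mul, even_two, Even.neg_pow] at hint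
  exact (mul_eq_zero.1 hint).resolve_left hl

/-! ### Sobolev spaces on the sphere -/

/-- The eigenvalue `λ_ℓ = ℓ (ℓ + d - 1)` of the negative Laplace-Beltrami operator of `S^d`. -/
def eigenvalue (d ℓ : ℕ) : ℝ := (ℓ : ℝ) * ((ℓ : ℝ) + d - 1)

/-- `u n ≍ v n`: `c₁ u n ≤ v n ≤ c₂ u n` for all `n`, with positive constants. -/
def Comparable (u v : ℕ → ℝ) : Prop :=
  ∃ c₁ c₂ : ℝ, 0 < c₁ ∧ 0 < c₂ ∧ ∀ n, c₁ * u n ≤ v n ∧ v n ≤ c₂ * u n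

/-- The Laplace-Fourier coefficients `∫ f Y_{ℓ,k} dσ_d`. -/
noncomputable def fourierCoeffSph {d : ℕ} (Y : (ℓ : ℕ) → Fin (harmonicDim d ℓ) → C(Sph d, ℝ))
    (f : Lp ℝ 2 (surfaceMeasure d)) (ℓ : ℕ) (k : Fin (harmonicDim d ℓ)) : ℝ :=
  ∫ x, f x * Y ℓ k x ∂(surfaceMeasure d)

theorem fourierCoeffSph_integrable {d : ℕ}
    (Y : (ℓ : ℕ) → Fin (harmonicDim d ℓ) → C(Sph d, ℝ)) (f : Lp ℝ 2 (surfaceMeasure d))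
    (ℓ : ℕ) (k : Fin (harmonicDim d ℓ)) :
    Integrable (fun x => f x * Y ℓ k x) (surfaceMeasure d) := by
  have h : MemLp (fun x => Y ℓ k x) 2 (surfaceMeasure d) :=
    (memLp_congr_ae (ContinuousMap.coeFn_toLp (surfaceMeasure d) (𝕜 := ℝ) (Y ℓ k))).1
      (Lp.memLp (ContinuousMap.toLp 2 (surfaceMeasure d) ℝ (Y ℓ k)))
  exact (Lp.memLp f).integrable_mul h

theorem fourierCoeffSph_add {d : ℕ} (Y : (ℓ : ℕ) → Fin (harmonicDim d ℓ) → C(Sph d, ℝ))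
    (f g : Lp ℝ 2 (surfaceMeasure d)) (ℓ : ℕ) (k : Fin (harmonicDim d ℓ)) :
    fourierCoeffSph Y (f + g) ℓ k = fourierCoeffSph Y f ℓ k + fourierCoeffSph Y g ℓ k := by
  unfold fourierCoeffSph
  rw [← integral_add (fourierCoeffSph_integrable Y f ℓ k) (fourierCoeffSph_integrable Y g ℓ k)]
  apply integral_congr_ae
  filter_upwards [Lp.coeFn_add f g] with x hx
  rw [hx, Pi.add_apply, add_mul]

theorem fourierCoeffSph_smul {d : ℕ} (Y : (ℓ : ℕ) → Fin (harmonicDim d ℓ) → C(Sph d, ℝ))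
    (c : ℝ) (f : Lp ℝ 2 (surfaceMeasure d)) (ℓ : ℕ) (k : Fin (harmonicDim d ℓ)) :
    fourierCoeffSph Y (c • f) ℓ k = c * fourierCoeffSph Y f ℓ k := by
  unfold fourierCoeffSph
  rw [← integral_const_mul]
  apply integral_congr_ae
  filter_upwards [Lp.coeFn_smul c f] with x hx
  rw [hx, Pi.smul_apply, smul_eq_mul, mul_assoc]

/-- The Sobolev space `H^s(S^d)`: all `f ∈ L₂(S^d)` whose Laplace-Fourier coefficients satisfy
`∑_ℓ ∑_k (1 + λ_ℓ)^s |f̂_{ℓ,k}|² < ∞`. -/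
noncomputable def sobolevSpace {d : ℕ} (Y : (ℓ : ℕ) → Fin (harmonicDim d ℓ) → C(Sph d, ℝ))
    (s : ℝ) : Submodule ℝ (Lp ℝ 2 (surfaceMeasure d)) where
  carrier := {f | Summable fun ℓ =>
    ∑ k, (1 + eigenvalue d ℓ) ^ s * |fourierCoeffSph Y f ℓ k| ^ 2}
  zero_mem' := by
    have h : ∀ ℓ k, fourierCoeffSph Y 0 ℓ k = 0 := fun ℓ k => by
      simpa using fourierCoeffSph_smul Y 0 0 ℓ k
    simp [h, summable_zero]
  add_mem' := by
    intro f g hf hg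
    have hb : ∀ ℓ, 0 ≤ 1 + eigenvalue d ℓ := by
      intro ℓ
      have : 0 ≤ eigenvalue d ℓ := by
        unfold eigenvalue
        cases ℓ with
        | zero => simp
        | succ m =>
          push_cast
          have : (m : ℝ) + 1 + d - 1 = m + d := by ring
          rw [this]; positivity
      linarith
    have hp : ∀ ℓ, 0 ≤ (1 + eigenvalue d ℓ) ^ s := fun ℓ => Real.rpow_nonneg (hb ℓ) s
    refine Summable.of_nonneg_of_le
      (fun ℓ => Finset.sum_nonneg fun k _ => mul_nonneg (hp ℓ) (sq_nonneg _))
      (fun ℓ => ?_) ((hf.add hg).mul_left 2)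
    rw [← Finset.sum_add_distrib, Finset.mul_sum]
    refine Finset.sum_le_sum fun k _ => ?_
    rw [fourierCoeffSph_add, sq_abs, sq_abs, sq_abs]
    nlinarith [mul_nonneg (hp ℓ)
      (sq_nonneg (fourierCoeffSph Y f ℓ k - fourierCoeffSph Y g ℓ k))]
  smul_mem' := by
    intro c f hf
    refine (hf.mul_left (|c| ^ 2)).congr fun ℓ => ?_
    rw [Finset.mul_sum]
    refine Finset.sum_congr rfl fun k _ => ?_
    rw [fourierCoeffSph_smul, abs_mul]
    ring

/-- The Sobolev norm `(∑_ℓ ∑_k a_ℓ⁻¹ |f̂_{ℓ,k}|²)^(1/2)` given by the sequence `a`. -/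
noncomputable def sobolevNorm {d : ℕ} (Y : (ℓ : ℕ) → Fin (harmonicDim d ℓ) → C(Sph d, ℝ))
    (a : ℕ → ℝ) (f : Lp ℝ 2 (surfaceMeasure d)) : ℝ :=
  √(∑' ℓ, ∑ k, 1 / a ℓ * |fourierCoeffSph Y f ℓ k| ^ 2)

/-- The class in `L₂(S^d)` of a continuous function. -/
noncomputable def toL2 {d : ℕ} (g : C(Sph d, ℝ)) : Lp ℝ 2 (surfaceMeasure d) :=
  ContinuousMap.toLp 2 (surfaceMeasure d) ℝ g

/-! ### Numerical integration and the worst-case error -/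

/-- The equal weight rule `Q[X_N](f) = N⁻¹ ∑_j f(x_j)`. -/
noncomputable def equalWeightRule {d N : ℕ} (x : Fin N → Sph d) (f : C(Sph d, ℝ)) : ℝ :=
  1 / (N : ℝ) * ∑ j, f (x j)

/-- The exact integral `I(f) = ∫ f dσ_d`. -/
noncomputable def exactIntegral {d : ℕ} (f : C(Sph d, ℝ)) : ℝ :=
  ∫ y, f y ∂(surfaceMeasure d)

/-- The errors `|Q[X_N](f) - I(f)|` over the unit ball of a space `B` of continuous functions
with norm `normB`. -/
def integrationErrors {d N : ℕ} (x : Fin N → Sph d) (B : Set C(Sph d, ℝ))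
    (normB : C(Sph d, ℝ) → ℝ) : Set ℝ :=
  {e | ∃ f ∈ B, normB f ≤ 1 ∧ e = |equalWeightRule x f - exactIntegral f|}

/-- The worst-case error of the equal weight rule with nodes `x` over a space `B` of continuous
functions with norm `normB`. -/
noncomputable def worstCaseError {d N : ℕ} (x : Fin N → Sph d) (B : Set C(Sph d, ℝ))
    (normB : C(Sph d, ℝ) → ℝ) : ℝ :=
  sSup (integrationErrors x B normB)

/-- `H^s(S^d)` as a space of continuous functions: the continuous functions whose class in
`L₂(S^d)` lies in `H^s(S^d)`. -/
def sobolevContinuous {d : ℕ} (Y : (ℓ : ℕ) → Fin (harmonicDim d ℓ) → C(Sph d, ℝ))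
    (s : ℝ) : Set C(Sph d, ℝ) :=
  {g | toL2 g ∈ sobolevSpace Y s}

/-- The term `a_ℓ Z(d, ℓ) P_ℓ^{(d)}(t)` of the kernel expansion. -/
noncomputable def kernelTerm (d : ℕ) (a : ℕ → ℝ) (t : ℝ) (ℓ : ℕ) : ℝ :=
  a ℓ * harmonicDim d ℓ * (gegenbauerP d ℓ).eval t

/-- The kernel `𝒦(t) = ∑_{ℓ ≥ 1} a_ℓ Z(d, ℓ) P_ℓ^{(d)}(t)`. -/
noncomputable def calK (d : ℕ) (a : ℕ → ℝ) (t : ℝ) : ℝ :=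
  ∑' ℓ : ℕ, kernelTerm d a t (ℓ + 1)

/-! In terms of Fourier coefficients, the integration error of `g` is `∑ ĝ_{ℓ,k} m_{ℓ,k}` over `ℓ ≥
1`, where `m_{ℓ,k}` is the mean of `Y_{ℓ,k}` over the nodes: the degree-zero part of the rule is
exactly the integral. Cauchy-Schwarz with weights `1 / a_ℓ` and `a_ℓ` bounds the error on the unit
ball by `√B`, `B = ∑ a_ℓ |m_{ℓ,k}|²`, and the coefficients `a_ℓ m_{ℓ,k} / √B` attain this bound
(`IsHarmonicSystem.isGreatest_integrationErrors`). Expanding the square and using the addition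
theorem in each degree turns `B` into the double sum of the kernel.

The addition theorem is proved from scratch. Harmonics of different degrees are orthogonal, by
Gaussian integration by parts and polar coordinates. A dimension count shows that an orthonormal
system of `Z(d, ℓ)` harmonics is a basis, so its reproducing kernel is rotation invariant. The zonal
function `P_ℓ(⟪e, x⟫)` is a harmonic with the same invariance about `e`; functions so invariant
depend on `⟪e, x⟫` alone, and Weierstrass approximation makes the two proportional
(`IsHarmonicSystem.kernel_eq_smul_zonalFn`).

Continuous representatives come from `s > d / 2`, which makes `∑ a_ℓ Z(d, ℓ)` converge and hence the
Fourier series converge in sup norm (`IsHarmonicSystem.exists_hasSum`). The limit represents the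
given element because the harmonics are complete: every polynomial agrees on the sphere with a sum
of harmonics, and polynomials are dense. -/

/-! ### Fischer decomposition and the dimension of harmonic polynomials. -/

section HarmonicPolynomials

open MvPolynomial

variable {σ : Type*} [Fintype σ]

/-- The Laplacian on polynomials. -/
noncomputable def polyLap : MvPolynomial σ ℝ →ₗ[ℝ] MvPolynomial σ ℝ :=
  ∑ i, (pderiv i).toLinearMap ∘ₗ (pderiv i).toLinearMap

theorem polyLap_apply (p : MvPolynomial σ ℝ) : polyLap p = ∑ i, pderiv i (pderiv i p) := by
  simp [polyLap]

/-- The polynomial `∑ i, X i ^ 2`. -/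
noncomputable def normSqPoly (σ : Type*) [Fintype σ] : MvPolynomial σ ℝ := ∑ i, X i ^ 2

theorem polyLap_mul (p q : MvPolynomial σ ℝ) :
    polyLap (p * q) = polyLap p * q + 2 * ∑ i, pderiv i p * pderiv i q + p * polyLap q := by
  simp only [polyLap_apply, Finset.sum_mul, Finset.mul_sum, ← Finset.sum_add_distrib]
  refine Finset.sum_congr rfl fun i _ => ?_
  simp only [Derivation.leibniz, smul_eq_mul, map_add]
  ring

theorem pderiv_normSqPoly (i : σ) : pderiv i (normSqPoly σ) = 2 * X i := by
  classical
  simp [normSqPoly, pderiv_X, Pi.single_apply]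

theorem polyLap_normSqPoly : polyLap (normSqPoly σ) = C (2 * (Fintype.card σ : ℝ)) := by
  have h (i : σ) : pderiv i (2 * X i : MvPolynomial σ ℝ) = 2 := by
    rw [show (2 : MvPolynomial σ ℝ) = C 2 from (map_ofNat C 2).symm, pderiv_C_mul, pderiv_X_self,
      mul_one]
  simp only [polyLap_apply, pderiv_normSqPoly, h]
  simp [mul_comm, map_ofNat]

theorem normSqPoly_isHomogeneous : (normSqPoly σ).IsHomogeneous 2 :=
  IsHomogeneous.sum _ _ _ fun i _ => isHomogeneous_X_pow i 2

theorem normSqPoly_ne_zero [Nonempty σ] : normSqPoly σ ≠ 0 := by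
  intro h
  have := congrArg (eval fun _ => (1 : ℝ)) h
  simp [normSqPoly] at this

/-- The cross term of the product rule is `4 ∑ x_i ∂_i q`, which Euler's identity evaluates to `4 k
q`. -/
theorem polyLap_normSqPoly_mul {k : ℕ} {q : MvPolynomial σ ℝ} (hq : q.IsHomogeneous k) :
    polyLap (normSqPoly σ * q) =
      C (2 * (Fintype.card σ : ℝ) + 4 * k) * q + normSqPoly σ * polyLap q := by
  have he := hq.sum_X_mul_pderiv
  rw [polyLap_mul, polyLap_normSqPoly]
  have : ∑ i, pderiv i (normSqPoly σ) * pderiv i q = 2 * (k • q) := by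
    rw [← he, Finset.mul_sum]
    exact Finset.sum_congr rfl fun i _ => by rw [pderiv_normSqPoly, mul_assoc]
  rw [this]
  simp only [nsmul_eq_mul, map_add, map_mul, map_natCast, map_ofNat]
  ring

/-- Peeling off one factor `|x|²` at a time accumulates positive constants; later arguments use only
that their sum is nonzero. -/
theorem polyLap_normSqPoly_pow_mul [Nonempty σ] (j k : ℕ) : ∃ c : ℝ, 0 < c ∧
    ∀ q : MvPolynomial σ ℝ, q.IsHomogeneous k →
      polyLap (normSqPoly σ ^ (j + 1) * q) =
        C c * (normSqPoly σ ^ j * q) + normSqPoly σ ^ (j + 1) * polyLap q := by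
  induction j with
  | zero =>
    refine ⟨2 * (Fintype.card σ : ℝ) + 4 * k, ?_, fun q hq => ?_⟩
    · have : 0 < Fintype.card σ := Fintype.card_pos
      positivity
    · simpa using polyLap_normSqPoly_mul hq
  | succ j ih =>
    obtain ⟨c, hc, h⟩ := ih
    refine ⟨2 * (Fintype.card σ : ℝ) + 4 * ((2 * (j + 1) + k : ℕ) : ℝ) + c, by positivity,
      fun q hq => ?_⟩
    rw [pow_succ' _ (j + 1), mul_assoc,
      polyLap_normSqPoly_mul ((normSqPoly_isHomogeneous.pow (j + 1)).mul hq), h q hq]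
    rw [map_add C _ c]
    ring

theorem polyLap_isHomogeneous {n : ℕ} {p : MvPolynomial σ ℝ} (hp : p.IsHomogeneous n) :
    (polyLap p).IsHomogeneous (n - 2) := by
  rw [polyLap_apply]
  exact IsHomogeneous.sum _ _ _ fun i _ => hp.pderiv.pderiv

/-- The truncated degree `n - 2` does not show this vanishing, which is what ends the inductions
that descend by two. -/
theorem polyLap_eq_zero_of_lt_two {n : ℕ} (hn : n < 2) {p : MvPolynomial σ ℝ}
    (hp : p.IsHomogeneous n) : polyLap p = 0 := by
  rw [polyLap_apply]
  refine Finset.sum_eq_zero fun i _ => ?_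
  have h : (pderiv i p).IsHomogeneous 0 := by
    have := hp.pderiv (i := i)
    rwa [show n - 1 = 0 by omega] at this
  obtain ⟨c, hc⟩ : ∃ c, C c = pderiv i p :=
    ⟨_, (totalDegree_eq_zero_iff_eq_C.1 ((totalDegree_zero_iff_isHomogeneous _).2 h)).symm⟩
  rw [← hc, pderiv_C]

/-- The product formula gives `c p + |x|² Δp = 0`, so `p = |x|² q` with `q` of degree `n - 2`. Then
`|x|^(2(j+1)) p = |x|^(2(j+2)) q`, and the hypothesis passes to `q` with a larger power; this is why
`j` varies in the induction. -/
theorem eq_zero_of_polyLap_normSqPoly_pow_mul [Nonempty σ] (n : ℕ) :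
    ∀ (j : ℕ) (p : MvPolynomial σ ℝ), p.IsHomogeneous n →
      polyLap (normSqPoly σ ^ (j + 1) * p) = 0 → p = 0 := by
  induction n using Nat.strong_induction_on with
  | _ n ih =>
    intro j p hp h0
    obtain ⟨c, hc, h⟩ := polyLap_normSqPoly_pow_mul (σ := σ) j n
    rw [h p hp, pow_succ, mul_assoc, mul_left_comm, ← mul_add] at h0
    have h1 := (mul_eq_zero.1 h0).resolve_left (pow_ne_zero _ normSqPoly_ne_zero)
    have hp' : p = normSqPoly σ * (C (-c⁻¹) * polyLap p) := by
      have hcc : (C c⁻¹ * C c : MvPolynomial σ ℝ) = 1 := by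
        rw [← C_mul, inv_mul_cancel₀ hc.ne', C_1]
      rw [map_neg]
      linear_combination C c⁻¹ * h1 - p * hcc
    rcases lt_or_ge n 2 with hn | hn
    · rw [hp', polyLap_eq_zero_of_lt_two hn hp]; simp
    · have hq : (C (-c⁻¹) * polyLap p).IsHomogeneous (n - 2) := (polyLap_isHomogeneous hp).C_mul _
      have := ih (n - 2) (by omega) (j + 1) _ hq (by
        rw [pow_succ, mul_assoc, ← hp', h p hp, pow_succ, mul_assoc, mul_left_comm, ← mul_add, h1,
          mul_zero])
      rw [hp', this, mul_zero]

instance homogeneousSubmodule_finiteDimensional (n : ℕ) :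
    FiniteDimensional ℝ (homogeneousSubmodule σ ℝ n) :=
  Module.Finite.iff_fg.2 (homogeneousSubmodule_fg σ ℝ n)

/-- Multiplication by `|x|²` followed by the Laplacian is an injective endomorphism of a
finite-dimensional space, hence surjective. -/
theorem exists_polyLap_normSqPoly_mul_eq [Nonempty σ] {n : ℕ} {p : MvPolynomial σ ℝ}
    (hp : p.IsHomogeneous n) :
    ∃ q : MvPolynomial σ ℝ, q.IsHomogeneous n ∧ polyLap (normSqPoly σ * q) = p := by
  let T : homogeneousSubmodule σ ℝ n →ₗ[ℝ] homogeneousSubmodule σ ℝ n :=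
    (polyLap ∘ₗ LinearMap.mulLeft ℝ (normSqPoly σ)).restrict fun q hq => by
      have := polyLap_isHomogeneous (normSqPoly_isHomogeneous.mul hq)
      rwa [show 2 + n - 2 = n by omega] at this
  have hT : Function.Injective T := by
    rw [← LinearMap.ker_eq_bot, LinearMap.ker_eq_bot']
    intro q hq
    have := congrArg Subtype.val hq
    exact Subtype.ext (eq_zero_of_polyLap_normSqPoly_pow_mul n 0 q.1 q.2
      (by rw [zero_add, pow_one]; exact this))
  obtain ⟨q, hq⟩ := LinearMap.surjective_of_injective hT ⟨p, hp⟩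
  exact ⟨q.1, q.2, congrArg Subtype.val hq⟩

theorem exists_harmonic_add_normSqPoly_mul [Nonempty σ] {n : ℕ} {p : MvPolynomial σ ℝ}
    (hp : p.IsHomogeneous (n + 2)) :
    ∃ h q : MvPolynomial σ ℝ, h.IsHomogeneous (n + 2) ∧ polyLap h = 0 ∧ q.IsHomogeneous n ∧
      p = h + normSqPoly σ * q := by
  obtain ⟨q, hq, he⟩ := exists_polyLap_normSqPoly_mul_eq (polyLap_isHomogeneous hp)
  rw [Nat.add_sub_cancel] at hq
  refine ⟨p - normSqPoly σ * q, q, hp.sub ?_, by rw [map_sub, he, sub_self], hq, by ring⟩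
  have := normSqPoly_isHomogeneous.mul hq
  rwa [add_comm] at this

/-- The space of homogeneous harmonic polynomials of degree `n`. -/
noncomputable def harmonicSubmodule (σ : Type*) [Fintype σ] (n : ℕ) :
    Submodule ℝ (MvPolynomial σ ℝ) :=
  homogeneousSubmodule σ ℝ n ⊓ LinearMap.ker polyLap

instance harmonicSubmodule_finiteDimensional (n : ℕ) :
    FiniteDimensional ℝ (harmonicSubmodule σ n) :=
  Submodule.finiteDimensional_inf_left _ _

theorem finrank_homogeneousSubmodule (n : ℕ) :
    Module.finrank ℝ (homogeneousSubmodule σ ℝ n) = (Fintype.card σ + n - 1).choose n := by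
  classical
  rw [homogeneousSubmodule_eq_finsupp_supported]
  have h2 : {d : σ →₀ ℕ | d.degree = n} = ((Finset.univ : Finset σ).finsuppAntidiag n : Set _) := by
    ext d
    simp [Finset.mem_finsuppAntidiag, Finsupp.degree_eq_sum]
  rw [h2]
  refine (Module.finrank_eq_card_basis (basisRestrictSupport ℝ
    ((Finset.univ : Finset σ).finsuppAntidiag n : Set (σ →₀ ℕ)))).trans ?_
  simpa using Finset.card_finsuppAntidiag_nat_eq_choose (s := (Finset.univ : Finset σ)) n

/-- Rank-nullity for the Laplacian from degree `n + 2` to degree `n`, which is onto with preimages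
divisible by `|x|²`. -/
theorem finrank_harmonicSubmodule_add_two [Nonempty σ] (n : ℕ) :
    Module.finrank ℝ (harmonicSubmodule σ (n + 2)) + Module.finrank ℝ (homogeneousSubmodule σ ℝ n) =
      Module.finrank ℝ (homogeneousSubmodule σ ℝ (n + 2)) := by
  let T : homogeneousSubmodule σ ℝ (n + 2) →ₗ[ℝ] homogeneousSubmodule σ ℝ n :=
    polyLap.restrict fun q hq => polyLap_isHomogeneous hq
  have hs : LinearMap.range T = ⊤ := by
    rw [LinearMap.range_eq_top]
    intro p
    obtain ⟨q, hq, he⟩ := exists_polyLap_normSqPoly_mul_eq p.2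
    refine ⟨⟨normSqPoly σ * q, ?_⟩, Subtype.ext he⟩
    have := normSqPoly_isHomogeneous.mul hq
    rwa [add_comm] at this
  have hk : Module.finrank ℝ (LinearMap.ker T) = Module.finrank ℝ (harmonicSubmodule σ (n + 2)) := by
    have : harmonicSubmodule σ (n + 2) = (LinearMap.ker T).map (Submodule.subtype _) := by
      ext p
      simp only [harmonicSubmodule, Submodule.mem_inf, Submodule.mem_map, LinearMap.mem_ker,
        Submodule.subtype_apply]
      constructor
      · rintro ⟨h1, h2⟩
        exact ⟨⟨p, h1⟩, Subtype.ext h2, rfl⟩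
      · rintro ⟨q, hq, rfl⟩
        exact ⟨q.2, congrArg Subtype.val hq⟩
    rw [this]
    exact (LinearEquiv.finrank_eq (Submodule.equivMapOfInjective _
      (Submodule.subtype_injective _) _))
  have := LinearMap.finrank_range_add_finrank_ker T
  rw [hs, finrank_top, hk] at this
  omega

/-- Clearing factorials reduces this to a polynomial identity, which also shows that the division
defining `harmonicDim` is exact. The additive form avoids truncated subtraction. -/
theorem harmonicDim_add_choose (d n : ℕ) (hd : 2 ≤ d) :
    harmonicDim d (n + 2) + (n + d).choose n = (n + 2 + d).choose (n + 2) := by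
  obtain ⟨e, rfl⟩ := Nat.exists_eq_add_of_le' hd
  have h1 : (n + (e + 2)).choose n * n.factorial * (e + 2).factorial = (n + (e + 2)).factorial := by
    simpa using Nat.choose_mul_factorial_mul_factorial (Nat.le_add_right n (e + 2))
  have h2 : (n + 2 + (e + 2)).choose (n + 2) * (n + 2).factorial * (e + 2).factorial =
      (n + 2 + (e + 2)).factorial := by
    simpa using Nat.choose_mul_factorial_mul_factorial (Nat.le_add_right (n + 2) (e + 2))
  set A := (n + (e + 2)).choose n
  set B := (n + 2 + (e + 2)).choose (n + 2)
  have hZ : 0 < (e + 1).factorial * (n + 2).factorial := by positivity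
  have key : (2 * (n + 2) + (e + 2) - 1) * ((n + 2) + (e + 2) - 2).factorial +
      ((e + 1).factorial * (n + 2).factorial) * A = ((e + 1).factorial * (n + 2).factorial) * B := by
    rw [show 2 * (n + 2) + (e + 2) - 1 = 2 * n + e + 5 by omega,
      show (n + 2) + (e + 2) - 2 = n + (e + 2) by omega]
    apply Nat.eq_of_mul_eq_mul_left (show 0 < e + 2 by omega)
    have h3 : (e + 2).factorial = (e + 2) * (e + 1).factorial := Nat.factorial_succ _
    have h4 : (n + 2).factorial = (n + 2) * ((n + 1) * n.factorial) := by
      rw [Nat.factorial_succ, Nat.factorial_succ]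
    have h5 : (n + 2 + (e + 2)).factorial =
        (n + e + 4) * ((n + e + 3) * (n + (e + 2)).factorial) := by
      rw [show n + 2 + (e + 2) = n + (e + 2) + 1 + 1 by ring, Nat.factorial_succ, Nat.factorial_succ]
      ring
    rw [h5] at h2
    rw [h3] at h1 h2
    have h1' : (e + 2) * (((e + 1).factorial * (n + 2).factorial) * A) =
        (n + 2) * (n + 1) * (n + (e + 2)).factorial := by rw [← h1, h4]; ring
    have h2' : (e + 2) * (((e + 1).factorial * (n + 2).factorial) * B) =
        (n + e + 4) * ((n + e + 3) * (n + (e + 2)).factorial) := by rw [← h2]; ring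
    rw [mul_add, h1', h2']
    ring
  have hle : A ≤ B := by
    have := (Nat.le_add_left _ _).trans_eq key
    exact Nat.le_of_mul_le_mul_left this hZ
  have : harmonicDim (e + 2) (n + 2) = B - A := by
    unfold harmonicDim
    rw [show e + 2 - 1 = e + 1 by omega]
    apply Nat.div_eq_of_eq_mul_right hZ
    rw [Nat.mul_sub]
    omega
  omega

/-- An upper bound suffices: orthonormality of `Y n` supplies the opposite inequality. -/
theorem finrank_harmonicSubmodule_le (d n : ℕ) (hd : 2 ≤ d) :
    Module.finrank ℝ (harmonicSubmodule (Fin (d + 1)) n) ≤ harmonicDim d n := by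
  have hV : ∀ n, Module.finrank ℝ (homogeneousSubmodule (Fin (d + 1)) ℝ n) = (n + d).choose n := by
    intro n
    rw [finrank_homogeneousSubmodule, Fintype.card_fin]
    congr 1; omega
  rcases lt_or_ge n 2 with hn | hn
  · refine (Submodule.finrank_mono inf_le_left).trans ?_
    rw [hV]
    obtain ⟨e, rfl⟩ := Nat.exists_eq_add_of_le' hd
    unfold harmonicDim
    rw [show e + 2 - 1 = e + 1 by omega]
    interval_cases n
    · simp [Nat.factorial_succ, Nat.div_self, Nat.factorial_pos]
    · rw [show 1 + (e + 2) - 2 = e + 1 by omega, show 2 * 1 + (e + 2) - 1 = e + 3 by omega]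
      have : (e + 3) * (e + 1).factorial / ((e + 1).factorial * Nat.factorial 1) = e + 3 := by
        rw [Nat.factorial_one, mul_one]
        exact Nat.mul_div_cancel _ (Nat.factorial_pos _)
      rw [this, Nat.choose_one_right]
      omega
  · obtain ⟨m, rfl⟩ := Nat.exists_eq_add_of_le' hn
    have h1 := finrank_harmonicSubmodule_add_two (σ := Fin (d + 1)) m
    have h2 := harmonicDim_add_choose d m hd
    rw [hV, hV] at h1
    omega

end HarmonicPolynomials

/-! ### Zonal harmonics and orthogonal changes of variables. -/

section ZonalPolynomials

open MvPolynomial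

variable {σ : Type*} [Fintype σ]

/-- The linear form `x ↦ ∑ i, e i * x i`. -/
noncomputable def linPoly (e : σ → ℝ) : MvPolynomial σ ℝ := ∑ i, C (e i) * X i

/-- The derivative in direction `e`. -/
noncomputable def dirDeriv (e : σ → ℝ) : Derivation ℝ (MvPolynomial σ ℝ) (MvPolynomial σ ℝ) :=
  ∑ i, e i • pderiv i

theorem dirDeriv_apply (e : σ → ℝ) (p : MvPolynomial σ ℝ) :
    dirDeriv e p = ∑ i, C (e i) * pderiv i p := by
  simp only [dirDeriv, ← MvPolynomial.smul_eq_C_mul]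
  induction (Finset.univ : Finset σ) using Finset.cons_induction with
  | empty => simp
  | cons a s h ih => simp [Finset.sum_cons, ih]

theorem pderiv_linPoly (e : σ → ℝ) (i : σ) : pderiv i (linPoly e) = C (e i) := by
  classical
  simp [linPoly, pderiv_X, Pi.single_apply]

theorem polyLap_linPoly_mul (e : σ → ℝ) (p : MvPolynomial σ ℝ) :
    polyLap (linPoly e * p) = 2 * dirDeriv e p + linPoly e * polyLap p := by
  rw [polyLap_mul]
  have : polyLap (linPoly e) = 0 := by simp [polyLap_apply, pderiv_linPoly]
  simp [this, pderiv_linPoly, dirDeriv_apply]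

theorem dirDeriv_linPoly {e : σ → ℝ} (he : ∑ i, e i ^ 2 = 1) : dirDeriv e (linPoly e) = 1 := by
  simp only [dirDeriv_apply, pderiv_linPoly, ← C_mul, ← map_sum]
  simp only [← sq, he, C_1]

theorem dirDeriv_normSqPoly (e : σ → ℝ) : dirDeriv e (normSqPoly σ) = 2 * linPoly e := by
  simp only [dirDeriv_apply, pderiv_normSqPoly, linPoly, Finset.mul_sum]
  exact Finset.sum_congr rfl fun _ _ => by ring

theorem linPoly_isHomogeneous (e : σ → ℝ) : (linPoly e).IsHomogeneous 1 :=
  IsHomogeneous.sum _ _ _ fun _ _ => isHomogeneous_C_mul_X _ _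

/-- The homogeneous polynomial `|x|^n P_n(⟨e, x⟩ / |x|)`. -/
noncomputable def zonalPoly (d : ℕ) (e : σ → ℝ) : ℕ → MvPolynomial σ ℝ
  | 0 => 1
  | 1 => linPoly e
  | n + 2 => C (((n : ℝ) + d)⁻¹) *
      (C (2 * (n : ℝ) + d + 1) * linPoly e * zonalPoly d e (n + 1)
        - C ((n : ℝ) + 1) * (normSqPoly σ * zonalPoly d e n))

theorem zonalPoly_isHomogeneous (d : ℕ) (e : σ → ℝ) (n : ℕ) :
    (zonalPoly d e n).IsHomogeneous n := by
  induction n using Nat.twoStepInduction with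
  | zero => exact isHomogeneous_one _ _
  | one => exact linPoly_isHomogeneous e
  | more n h0 h1 =>
    rw [zonalPoly]
    refine IsHomogeneous.C_mul (IsHomogeneous.sub ?_ (IsHomogeneous.C_mul ?_ _)) _
    · have := ((linPoly_isHomogeneous e).C_mul (2 * (n : ℝ) + d + 1)).mul h1
      rwa [show 1 + (n + 1) = n + 2 by ring] at this
    · have := normSqPoly_isHomogeneous.mul h0
      rwa [add_comm] at this

theorem zonalPoly_rec (d n : ℕ) (hd : 2 ≤ d) (e : σ → ℝ) :
    C ((n : ℝ) + d) * zonalPoly d e (n + 2) =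
      C (2 * (n : ℝ) + d + 1) * linPoly e * zonalPoly d e (n + 1)
        - C ((n : ℝ) + 1) * (normSqPoly σ * zonalPoly d e n) := by
  have h : ((n : ℝ) + d) ≠ 0 := by positivity
  rw [zonalPoly, ← mul_assoc, ← C_mul, mul_inv_cancel₀ h, C_1, one_mul]

/-- Differentiating the three-term recurrence along `e` and applying the recurrence once more. This
evaluates the cross term when the Laplacian hits `⟨e, x⟩` times a zonal polynomial. -/
theorem dirDeriv_zonalPoly (d : ℕ) (hd : 2 ≤ d) {e : σ → ℝ} (he : ∑ i, e i ^ 2 = 1) (n : ℕ) :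
    dirDeriv e (zonalPoly d e (n + 1)) = C ((n : ℝ) + 1) * zonalPoly d e n := by
  have hC (n : ℕ) : (C ((n : ℝ) + d) : MvPolynomial σ ℝ) ≠ 0 := by
    rw [Ne, C_eq_zero]; positivity
  have hD (r : ℝ) : dirDeriv e (C r) = 0 := by
    simp
  have hL (n : ℕ) := congrArg (dirDeriv e) (zonalPoly_rec d n hd e)
  simp only [Derivation.leibniz, smul_eq_mul, map_sub, hD, mul_zero, add_zero,
    dirDeriv_linPoly he, dirDeriv_normSqPoly] at hL
  induction n using Nat.twoStepInduction with
  | zero => simp [zonalPoly, dirDeriv_linPoly he]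
  | one =>
    apply mul_left_cancel₀ (hC 0)
    rw [hL 0]
    simp only [zonalPoly, dirDeriv_linPoly he, Derivation.map_one_eq_zero]
    simp only [map_add, map_mul, map_natCast, map_ofNat, map_one]
    push_cast
    ring
  | more n h0 h1 =>
    apply mul_left_cancel₀ (hC (n + 1))
    have := hL (n + 1)
    have hr := zonalPoly_rec d n hd e
    rw [show n + 1 + 2 = n + 2 + 1 from rfl, show n + 1 + 1 = n + 2 from rfl] at *
    rw [this, h1, h0]
    simp only [map_add, map_mul, map_natCast, map_ofNat, map_one, Nat.cast_add, Nat.cast_one,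
      Nat.cast_ofNat] at hr ⊢
    linear_combination (-(n : MvPolynomial σ ℝ) - 2) * hr

theorem polyLap_C_mul (r : ℝ) (p : MvPolynomial σ ℝ) : polyLap (C r * p) = C r * polyLap p := by
  rw [← MvPolynomial.smul_eq_C_mul, map_smul, MvPolynomial.smul_eq_C_mul]

/-- In the recurrence the two surviving multiples of the degree-`n` polynomial are `2 (2n + d + 1)(n
+ 1)` and `(n + 1)(2(d + 1) + 4n)`. They cancel exactly because there are `d + 1` variables. -/
theorem polyLap_zonalPoly (d : ℕ) (hd : 2 ≤ d) (hσ : Fintype.card σ = d + 1) {e : σ → ℝ}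
    (he : ∑ i, e i ^ 2 = 1) (n : ℕ) : polyLap (zonalPoly d e n) = 0 := by
  induction n using Nat.twoStepInduction with
  | zero => exact polyLap_eq_zero_of_lt_two (by norm_num) (zonalPoly_isHomogeneous d e 0)
  | one => exact polyLap_eq_zero_of_lt_two (by norm_num) (zonalPoly_isHomogeneous d e 1)
  | more n h0 h1 =>
    rw [zonalPoly, polyLap_C_mul, map_sub, mul_assoc, polyLap_C_mul, polyLap_C_mul,
      polyLap_linPoly_mul, polyLap_normSqPoly_mul (zonalPoly_isHomogeneous d e n), h0, h1,
      dirDeriv_zonalPoly d hd he, hσ]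
    simp only [map_add, map_mul, map_natCast, map_ofNat, map_one, Nat.cast_add, Nat.cast_one]
    ring

theorem eval_zonalPoly (d : ℕ) (e x : σ → ℝ) (hx : ∑ i, x i ^ 2 = 1) (n : ℕ) :
    eval x (zonalPoly d e n) = (gegenbauerP d n).eval (∑ i, e i * x i) := by
  have hl : eval x (linPoly e) = ∑ i, e i * x i := by simp [linPoly]
  have hN : eval x (normSqPoly σ) = 1 := by simp [normSqPoly, hx]
  induction n using Nat.twoStepInduction with
  | zero => simp [zonalPoly, gegenbauerP]
  | one => simp [zonalPoly, gegenbauerP, hl]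
  | more n h0 h1 =>
    simp only [zonalPoly, gegenbauerP, map_mul, map_sub, eval_C, hl, hN, h0, h1,
      Polynomial.eval_mul, Polynomial.eval_sub, Polynomial.eval_C, Polynomial.eval_X, one_mul]

theorem pderiv_aeval_linPoly (R : σ → σ → ℝ) (i : σ) (p : MvPolynomial σ ℝ) :
    pderiv i (aeval (fun j => linPoly (R j)) p) =
      ∑ j, C (R j i) * aeval (fun j => linPoly (R j)) (pderiv j p) := by
  classical
  induction p using MvPolynomial.induction_on with
  | C a => simp
  | add p q hp hq => simp only [map_add, hp, hq, mul_add, Finset.sum_add_distrib]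
  | mul_X p k hp =>
    simp only [map_mul, aeval_X, Derivation.leibniz, smul_eq_mul, hp, pderiv_linPoly, map_add,
      pderiv_X, mul_add, Finset.sum_add_distrib, Finset.mul_sum]
    congr 1
    · rw [Finset.sum_eq_single k]
      · simp [mul_comm]
      · intro j _ hj
        simp [hj.symm]
      · simp
    · exact Finset.sum_congr rfl fun j _ => by ring

/-- By the chain rule the second derivatives are contracted with `R Rᵀ`, which is the identity. -/
theorem polyLap_aeval_linPoly [DecidableEq σ] (R : σ → σ → ℝ)
    (hR : ∀ j k, ∑ i, R j i * R k i = if j = k then 1 else 0) (p : MvPolynomial σ ℝ) :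
    polyLap (aeval (fun j => linPoly (R j)) p) = aeval (fun j => linPoly (R j)) (polyLap p) := by
  simp only [polyLap_apply, pderiv_aeval_linPoly, map_sum, pderiv_C_mul, Finset.mul_sum]
  rw [Finset.sum_comm]
  refine Finset.sum_congr rfl fun j _ => ?_
  rw [Finset.sum_comm]
  have (k : σ) : ∑ i, C (R j i) * (C (R k i) *
      aeval (fun j => linPoly (R j)) (pderiv k (pderiv j p))) =
      C (if j = k then 1 else 0) * aeval (fun j => linPoly (R j)) (pderiv k (pderiv j p)) := by
    rw [← hR, map_sum, Finset.sum_mul]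
    exact Finset.sum_congr rfl fun i _ => by rw [C_mul, mul_assoc]
  simp only [this]
  simp

theorem isHomogeneous_aeval_linPoly (R : σ → σ → ℝ) {n : ℕ} {p : MvPolynomial σ ℝ}
    (hp : p.IsHomogeneous n) : (aeval (fun j => linPoly (R j)) p).IsHomogeneous n := by
  simpa using hp.aeval (fun j => linPoly (R j)) (n := 1) fun j => linPoly_isHomogeneous (R j)

end ZonalPolynomials

/-! ### Orthogonality of harmonic polynomials under the Gaussian weight. -/

section GaussianIntegral

open MvPolynomial

theorem integrable_pow_mul_exp_neg_sq_half (n : ℕ) :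
    Integrable fun t : ℝ => t ^ n * Real.exp (-(1 / 2) * t ^ 2) := by
  have := integrable_rpow_mul_exp_neg_mul_sq (b := 1 / 2) (by norm_num) (s := (n : ℝ))
    (by have : (0 : ℝ) ≤ n := n.cast_nonneg
        linarith)
  simpa only [Real.rpow_natCast] using this

/-- The integrand is the derivative of `t ^ n * exp (-t² / 2)`. For `n = 0` the truncated exponent
is harmless, since its coefficient is zero. -/
theorem integral_hermite_pow (n : ℕ) :
    ∫ t : ℝ, (n * t ^ (n - 1) - t ^ (n + 1)) * Real.exp (-(1 / 2) * t ^ 2) = 0 := by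
  refine integral_eq_zero_of_hasDerivAt_of_integrable
    (f := fun t => t ^ n * Real.exp (-(1 / 2) * t ^ 2)) (fun t => ?_) ?_
    (integrable_pow_mul_exp_neg_sq_half n)
  · have h1 : HasDerivAt (fun t : ℝ => -(1 / 2) * t ^ 2) (-(1 / 2) * (2 * t)) t := by
      simpa using (hasDerivAt_pow 2 t).const_mul (-(1 / 2) : ℝ)
    refine ((hasDerivAt_pow n t).mul h1.exp).congr_deriv ?_
    ring
  · refine (((integrable_pow_mul_exp_neg_sq_half (n - 1)).const_mul (n : ℝ)).sub
      (integrable_pow_mul_exp_neg_sq_half (n + 1))).congr (ae_of_all _ fun t => ?_)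
    simp only [Pi.sub_apply]
    ring

variable {σ : Type*} [Fintype σ]

/-- The Gaussian weight `exp (-|x|² / 2)`. -/
noncomputable def gaussWeight (x : σ → ℝ) : ℝ := ∏ i, Real.exp (-(1 / 2) * x i ^ 2)

theorem integrable_eval_mul_gaussWeight (p : MvPolynomial σ ℝ) :
    Integrable fun x : σ → ℝ => eval x p * gaussWeight x := by
  induction p using MvPolynomial.induction_on' with
  | monomial s a =>
    have := (Integrable.fintype_prod (μ := fun _ : σ => (volume : Measure ℝ))
      fun i => integrable_pow_mul_exp_neg_sq_half (s i)).const_mul a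
    refine this.congr (ae_of_all _ fun x => ?_)
    simp only [eval_monomial, gaussWeight, Finset.prod_mul_distrib, Finsupp.prod_pow, mul_assoc]
  | add p q hp hq =>
    refine (hp.add hq).congr (ae_of_all _ fun x => ?_)
    simp only [map_add, add_mul, Pi.add_apply]

/-- Gaussian integration by parts. For a monomial the integral is a product over coordinates whose
`i`-th factor vanishes by `integral_hermite_pow`. -/
theorem integral_pderiv_sub_mul_gaussWeight (i : σ) (p : MvPolynomial σ ℝ) :
    ∫ x : σ → ℝ, eval x (pderiv i p - X i * p) * gaussWeight x = 0 := by
  classical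
  induction p using MvPolynomial.induction_on' with
  | monomial s a =>
    set f : σ → ℝ → ℝ := fun j t => (if j = i then s i * t ^ (s i - 1) - t ^ (s i + 1)
      else t ^ s j) * Real.exp (-(1 / 2) * t ^ 2) with hf
    have h (x : σ → ℝ) : eval x (pderiv i (monomial s a) - X i * monomial s a) * gaussWeight x =
        a * ∏ j, f j (x j) := by
      have e1 : ∏ j, x j ^ ((s - Finsupp.single i 1 : σ →₀ ℕ) j) =
          x i ^ (s i - 1) * ∏ j ∈ Finset.univ.erase i, x j ^ s j := by
        rw [← Finset.mul_prod_erase _ _ (Finset.mem_univ i)]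
        congr 1
        · simp
        · refine Finset.prod_congr rfl fun j hj => ?_
          simp [(Finset.ne_of_mem_erase hj).symm]
      have e2 : ∏ j, x j ^ s j = x i ^ s i * ∏ j ∈ Finset.univ.erase i, x j ^ s j :=
        (Finset.mul_prod_erase _ _ (Finset.mem_univ i)).symm
      have e3 : ∏ j, (if j = i then s i * x j ^ (s i - 1) - x j ^ (s i + 1) else x j ^ s j) =
          (s i * x i ^ (s i - 1) - x i ^ (s i + 1)) * ∏ j ∈ Finset.univ.erase i, x j ^ s j := by
        rw [← Finset.mul_prod_erase _ _ (Finset.mem_univ i), if_pos rfl]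
        congr 1
        exact Finset.prod_congr rfl fun j hj => if_neg (Finset.ne_of_mem_erase hj)
      simp only [hf, Finset.prod_mul_distrib, e3, map_sub, map_mul, eval_X, pderiv_monomial,
        eval_monomial, Finsupp.prod_pow, e1, e2, gaussWeight]
      ring
    simp only [h]
    rw [integral_const_mul, integral_fintype_prod_volume_eq_prod,
      Finset.prod_eq_zero (Finset.mem_univ i), mul_zero]
    simpa [hf] using integral_hermite_pow (s i)
  | add p q hp hq =>
    have h := integral_add (integrable_eval_mul_gaussWeight (pderiv i p - X i * p))
      (integrable_eval_mul_gaussWeight (pderiv i q - X i * q))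
    rw [hp, hq, add_zero] at h
    rw [← h]
    refine integral_congr_ae (ae_of_all _ fun x => ?_)
    simp only [map_add, map_sub, map_mul]
    ring

/-- The Gaussian integral as a linear functional on polynomials. -/
noncomputable def gaussIntegral (σ : Type*) [Fintype σ] : MvPolynomial σ ℝ →ₗ[ℝ] ℝ where
  toFun p := ∫ x : σ → ℝ, eval x p * gaussWeight x
  map_add' p q := by
    rw [← integral_add (integrable_eval_mul_gaussWeight p) (integrable_eval_mul_gaussWeight q)]
    simp only [map_add, add_mul]
  map_smul' c p := by
    rw [RingHom.id_apply, smul_eq_mul, ← integral_const_mul]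
    simp only [smul_eval, mul_assoc]

theorem gaussIntegral_pderiv_sub (i : σ) (p : MvPolynomial σ ℝ) :
    gaussIntegral σ (pderiv i p - X i * p) = 0 :=
  integral_pderiv_sub_mul_gaussWeight i p

/-- Integrate by parts with `∂_i p · q` and sum over `i`: harmonicity removes `Δp · q`, and Euler's
identity turns `∑ x_i ∂_i p` into `m p`. -/
theorem gaussIntegral_harmonic_mul {m : ℕ} {p : MvPolynomial σ ℝ} (hp : p.IsHomogeneous m)
    (hp0 : polyLap p = 0) (q : MvPolynomial σ ℝ) :
    m * gaussIntegral σ (p * q) = gaussIntegral σ (∑ i, pderiv i p * pderiv i q) := by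
  have h : ∑ i, gaussIntegral σ (pderiv i (pderiv i p * q) - X i * (pderiv i p * q)) = 0 :=
    Finset.sum_eq_zero fun i _ => gaussIntegral_pderiv_sub i _
  rw [← map_sum] at h
  have e : ∑ i, (pderiv i (pderiv i p * q) - X i * (pderiv i p * q)) =
      ∑ i, pderiv i p * pderiv i q - (m : ℝ) • (p * q) := by
    have he := hp.sum_X_mul_pderiv
    rw [polyLap_apply] at hp0
    have hsplit : ∀ i, pderiv i (pderiv i p * q) - X i * (pderiv i p * q) =
        pderiv i p * pderiv i q + q * pderiv i (pderiv i p) - (X i * pderiv i p) * q := by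
      intro i
      simp only [Derivation.leibniz, smul_eq_mul]
      ring
    simp only [hsplit, Finset.sum_sub_distrib, Finset.sum_add_distrib, ← Finset.mul_sum,
      ← Finset.sum_mul, hp0, he]
    simp [MvPolynomial.smul_eq_C_mul, mul_assoc]
  rw [e, map_sub, map_smul, smul_eq_mul] at h
  linarith

/-- The integral of `∑ ∂_i p ∂_i q` is symmetric in `p` and `q`, so it equals both `m` and `n` times
the integral of `p q`. -/
theorem gaussIntegral_harmonic_mul_harmonic {m n : ℕ} (hmn : m ≠ n) {p q : MvPolynomial σ ℝ}
    (hp : p.IsHomogeneous m) (hp0 : polyLap p = 0) (hq : q.IsHomogeneous n)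
    (hq0 : polyLap q = 0) : gaussIntegral σ (p * q) = 0 := by
  have h1 := gaussIntegral_harmonic_mul hp hp0 q
  have h2 := gaussIntegral_harmonic_mul hq hq0 p
  rw [mul_comm q p] at h2
  simp only [mul_comm (pderiv _ q)] at h2
  have : ((m : ℝ) - n) * gaussIntegral σ (p * q) = 0 := by rw [sub_mul, h1, h2, sub_self]
  exact (mul_eq_zero.1 this).resolve_left (sub_ne_zero.2 (by exact_mod_cast hmn))

theorem eval_smul_of_isHomogeneous {k : ℕ} {p : MvPolynomial σ ℝ} (hp : p.IsHomogeneous k) (r : ℝ)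
    (x : σ → ℝ) : eval (r • x) p = r ^ k * eval x p := by
  rw [eval_eq', eval_eq', Finset.mul_sum]
  refine Finset.sum_congr rfl fun s hs => ?_
  have : ∑ i, s i = k := by
    rw [← Finsupp.degree_eq_sum]
    by_contra h
    exact (mem_support_iff.1 hs) (hp.coeff_eq_zero h)
  simp only [Pi.smul_apply, smul_eq_mul, mul_pow, Finset.prod_mul_distrib,
    Finset.prod_pow_eq_pow_sum, this]
  ring

end GaussianIntegral

/-! ### From Gaussian integrals to the sphere; rotation invariance. -/

section SphereMeasure

open MvPolynomial Pointwise

theorem gaussWeight_ofLp {d : ℕ} (x : EuclideanSpace ℝ (Fin (d + 1))) :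
    gaussWeight (fun i => x i) = Real.exp (-(1 / 2) * ‖x‖ ^ 2) := by
  rw [gaussWeight, ← Real.exp_sum, EuclideanSpace.real_norm_sq_eq, Finset.mul_sum]

theorem integral_volumeIoiPow_ne_zero (d k : ℕ) :
    ∫ r : Set.Ioi (0 : ℝ), (r : ℝ) ^ k * Real.exp (-(1 / 2) * (r : ℝ) ^ 2)
      ∂(Measure.volumeIoiPow d) ≠ 0 := by
  have : ∫ r : Set.Ioi (0 : ℝ), (r : ℝ) ^ k * Real.exp (-(1 / 2) * (r : ℝ) ^ 2)
      ∂(Measure.volumeIoiPow d) =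
      ∫ y in Set.Ioi (0 : ℝ), y ^ ((d + k : ℕ) : ℝ) * Real.exp (-(1 / 2) * y ^ (2 : ℝ)) := by
    simp only [Measure.volumeIoiPow, ENNReal.ofReal]
    rw [integral_withDensity_eq_integral_smul,
      integral_subtype_comap measurableSet_Ioi fun a : ℝ ↦
        Real.toNNReal (a ^ d) • (a ^ k * Real.exp (-(1 / 2) * a ^ 2)),
      setIntegral_congr_fun measurableSet_Ioi fun x hx ↦ ?_]
    · rw [NNReal.smul_def, Real.coe_toNNReal _ (pow_nonneg (le_of_lt hx) _), smul_eq_mul,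
        Real.rpow_natCast, Real.rpow_two, pow_add, mul_assoc]
    · exact (measurable_subtype_coe.pow_const _).real_toNNReal
  have hq : (-1 : ℝ) < ((d + k : ℕ) : ℝ) := by
    have : (0 : ℝ) ≤ ((d + k : ℕ) : ℝ) := Nat.cast_nonneg _
    linarith
  rw [this, integral_rpow_mul_exp_neg_mul_rpow (by norm_num) hq (by norm_num)]
  have : 0 < Real.Gamma ((((d + k : ℕ) : ℝ) + 1) / 2) := Real.Gamma_pos_of_pos (by positivity)
  positivity

/-- In polar coordinates a homogeneous integrand splits into an angular and a radial factor. The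
radial one is nonzero, so vanishing of the Gaussian integral passes to the sphere. -/
theorem gaussIntegral_eq_toSphere {d k : ℕ} {p : MvPolynomial (Fin (d + 1)) ℝ}
    (hp : p.IsHomogeneous k) :
    gaussIntegral (Fin (d + 1)) p =
      (∫ x : Sph d, eval (fun i => (x : EuclideanSpace ℝ (Fin (d + 1))) i) p
        ∂(volume : Measure (EuclideanSpace ℝ (Fin (d + 1)))).toSphere) *
      ∫ r : Set.Ioi (0 : ℝ), (r : ℝ) ^ k * Real.exp (-(1 / 2) * (r : ℝ) ^ 2)
        ∂(Measure.volumeIoiPow d) := by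
  set μ : Measure (EuclideanSpace ℝ (Fin (d + 1))) := volume
  set F : EuclideanSpace ℝ (Fin (d + 1)) → ℝ := fun x =>
    eval (fun i => x i) p * gaussWeight (fun i => x i)
  have h1 : gaussIntegral (Fin (d + 1)) p = ∫ x, F x ∂μ :=
    ((EuclideanSpace.volume_preserving_symm_measurableEquiv_toLp (Fin (d + 1))).integral_comp
      (MeasurableEquiv.measurableEmbedding _)
      (fun x : Fin (d + 1) → ℝ => eval x p * gaussWeight x)).symm
  have h2 : ∫ x, F x ∂μ = ∫ x : ({(0)}ᶜ : Set (EuclideanSpace ℝ (Fin (d + 1)))), F x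
      ∂(μ.comap (↑)) := by
    rw [integral_subtype_comap (measurableSet_singleton _).compl F, restrict_compl_singleton]
  have h3 := μ.measurePreserving_homeomorphUnitSphereProd.integral_comp
    (Homeomorph.measurableEmbedding _) (fun z : Sph d × Set.Ioi (0 : ℝ) =>
      eval (fun i => (z.1 : EuclideanSpace ℝ (Fin (d + 1))) i) p *
        ((z.2 : ℝ) ^ k * Real.exp (-(1 / 2) * (z.2 : ℝ) ^ 2)))
  rw [integral_prod_mul (fun x : Sph d => eval (fun i => (x : EuclideanSpace ℝ (Fin (d + 1))) i) p)
    (fun r : Set.Ioi (0 : ℝ) => (r : ℝ) ^ k * Real.exp (-(1 / 2) * (r : ℝ) ^ 2)),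
    finrank_euclideanSpace_fin, Nat.add_sub_cancel] at h3
  rw [h1, h2, ← h3]
  refine integral_congr_ae (ae_of_all _ fun x => ?_)
  have hx : ‖(x : EuclideanSpace ℝ (Fin (d + 1)))‖ ≠ 0 := norm_ne_zero_iff.2 x.2
  simp only [F, gaussWeight_ofLp, homeomorphUnitSphereProd_apply_snd_coe,
    homeomorphUnitSphereProd_apply_fst_coe]
  have := eval_smul_of_isHomogeneous hp ‖(x : EuclideanSpace ℝ (Fin (d + 1)))‖⁻¹
    (fun i => (x : EuclideanSpace ℝ (Fin (d + 1))) i)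
  simp only [PiLp.smul_apply, smul_eq_mul, Pi.smul_def] at this ⊢
  rw [this, ← mul_assoc, mul_right_comm (_ ^ k), ← mul_pow, inv_mul_cancel₀ hx, one_pow, one_mul]

theorem integral_harmonic_mul_harmonic {d m n : ℕ} (hmn : m ≠ n) {f g : C(Sph d, ℝ)}
    (hf : IsSphericalHarmonic m f) (hg : IsSphericalHarmonic n g) :
    ∫ x, f x * g x ∂(surfaceMeasure d) = 0 := by
  obtain ⟨p, hp, hp0, hfp⟩ := hf
  obtain ⟨q, hq, hq0, hgq⟩ := hg
  have h := gaussIntegral_harmonic_mul_harmonic hmn hp (by rwa [polyLap_apply]) hq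
    (by rwa [polyLap_apply])
  rw [gaussIntegral_eq_toSphere (hp.mul hq)] at h
  have h' := (mul_eq_zero.1 h).resolve_right (integral_volumeIoiPow_ne_zero d (m + n))
  rw [surfaceMeasure, integral_smul_measure]
  simp only [hfp, hgq, ← map_mul, h', smul_zero]

/-- The action of a linear isometry on the sphere. -/
noncomputable def sphereMap {d : ℕ}
    (R : EuclideanSpace ℝ (Fin (d + 1)) ≃ₗᵢ[ℝ] EuclideanSpace ℝ (Fin (d + 1))) :
    C(Sph d, Sph d) where
  toFun x := ⟨R x, by simp⟩
  continuous_toFun := by fun_prop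

/-- The surface measure of a set is a multiple of the volume of the cone over it; a linear isometry
commutes with forming cones and preserves volume. -/
theorem measurePreserving_sphereMap {d : ℕ}
    (R : EuclideanSpace ℝ (Fin (d + 1)) ≃ₗᵢ[ℝ] EuclideanSpace ℝ (Fin (d + 1))) :
    MeasurePreserving (sphereMap R) (surfaceMeasure d) (surfaceMeasure d) := by
  refine MeasurePreserving.smul_measure ⟨(sphereMap R).continuous.measurable, ?_⟩ _
  ext s hs
  have hm := (sphereMap R).continuous.measurable
  rw [Measure.map_apply hm hs, Measure.toSphere_apply' _ (hm hs), Measure.toSphere_apply' _ hs]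
  congr 1
  have e : (Subtype.val '' (sphereMap R ⁻¹' s) : Set (EuclideanSpace ℝ (Fin (d + 1)))) =
      R ⁻¹' (Subtype.val '' s) := by
    ext x
    constructor
    · rintro ⟨y, hy, rfl⟩
      exact ⟨_, hy, rfl⟩
    · rintro ⟨y, hy, hxy⟩
      have hx : ‖x‖ = 1 := by
        rw [← R.norm_map, ← hxy]; simp
      refine ⟨⟨x, by simpa using hx⟩, ?_, rfl⟩
      have : sphereMap R ⟨x, by simpa using hx⟩ = y := Subtype.ext hxy.symm
      rwa [Set.mem_preimage, this]
  have e2 (A : Set (EuclideanSpace ℝ (Fin (d + 1)))) :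
      Set.Ioo (0 : ℝ) 1 • (R ⁻¹' A) = R ⁻¹' (Set.Ioo (0 : ℝ) 1 • A) := by
    ext x
    simp only [Set.mem_smul, Set.mem_preimage]
    constructor
    · rintro ⟨r, hr, y, hy, rfl⟩
      exact ⟨r, hr, R y, hy, by simp⟩
    · rintro ⟨r, hr, y, hy, h⟩
      exact ⟨r, hr, R.symm y, by simpa, by rw [← map_smul, h, R.symm_apply_apply]⟩
  rw [e, e2]
  exact R.measurePreserving.measure_preimage_emb R.toMeasurableEquiv.measurableEmbedding _

end SphereMeasure

/-! ### Spherical harmonics as restrictions of polynomials. -/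

section RestrictionToSphere

variable {d : ℕ}

instance surfaceMeasure_isOpenPosMeasure (d : ℕ) : (surfaceMeasure d).IsOpenPosMeasure := by
  exact MeasureTheory.Measure.isOpenPosMeasure_smul _ (ENNReal.inv_ne_zero.2 (measure_ne_top _ _))

theorem integrable_continuousMap (f : C(Sph d, ℝ)) : Integrable f (surfaceMeasure d) :=
  f.continuous.integrable_of_hasCompactSupport (HasCompactSupport.of_compactSpace _)

/-- Integration against a continuous function, as a linear functional. -/
noncomputable def integralMul (f : C(Sph d, ℝ)) : C(Sph d, ℝ) →ₗ[ℝ] ℝ where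
  toFun g := ∫ x, f x * g x ∂(surfaceMeasure d)
  map_add' g h := by
    refine Eq.trans (integral_congr_ae (ae_of_all _ fun x => ?_))
      (integral_add (integrable_continuousMap (f * g)) (integrable_continuousMap (f * h)))
    exact mul_add _ _ _
  map_smul' c g := by
    rw [RingHom.id_apply, smul_eq_mul, ← integral_const_mul]
    refine integral_congr_ae (ae_of_all _ fun x => ?_)
    simp only [ContinuousMap.smul_apply, smul_eq_mul]
    ring

theorem integralMul_apply (f g : C(Sph d, ℝ)) :
    integralMul f g = ∫ x, f x * g x ∂(surfaceMeasure d) := rfl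

theorem integralMul_comm (f g : C(Sph d, ℝ)) : integralMul f g = integralMul g f := by
  simp only [integralMul_apply, mul_comm]

theorem eq_zero_of_integralMul_self {f : C(Sph d, ℝ)} (h : integralMul f f = 0) : f = 0 := by
  rw [integralMul_apply, integral_eq_zero_iff_of_nonneg (fun x => mul_self_nonneg (f x))
    (integrable_continuousMap (f * f))] at h
  have := Continuous.ae_eq_iff_eq (surfaceMeasure d) (f.continuous.mul f.continuous)
    continuous_const |>.1 h
  ext x
  exact mul_self_eq_zero.1 (congrFun this x)

/-- The restriction of a polynomial to the sphere. -/
noncomputable def restrictSphere (d : ℕ) : MvPolynomial (Fin (d + 1)) ℝ →ₐ[ℝ] C(Sph d, ℝ) :=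
  MvPolynomial.aeval fun i => ⟨fun x => (x : EuclideanSpace ℝ (Fin (d + 1))) i, by fun_prop⟩

theorem restrictSphere_apply (p : MvPolynomial (Fin (d + 1)) ℝ) (x : Sph d) :
    restrictSphere d p x =
      MvPolynomial.eval (fun i => (x : EuclideanSpace ℝ (Fin (d + 1))) i) p := by
  induction p using MvPolynomial.induction_on with
  | C a => simp [restrictSphere]
  | add p q hp hq => simp [hp, hq]
  | mul_X p i hp => simp [hp]; simp [restrictSphere]

theorem isSphericalHarmonic_iff {n : ℕ} {f : C(Sph d, ℝ)} :
    IsSphericalHarmonic n f ↔ f ∈ (harmonicSubmodule (Fin (d + 1)) n).map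
      (restrictSphere d).toLinearMap := by
  simp only [IsSphericalHarmonic, Submodule.mem_map, harmonicSubmodule, Submodule.mem_inf,
    MvPolynomial.mem_homogeneousSubmodule, LinearMap.mem_ker, polyLap_apply]
  constructor
  · rintro ⟨p, h1, h2, h3⟩
    exact ⟨p, ⟨h1, h2⟩, by ext x; rw [h3, ← restrictSphere_apply]; rfl⟩
  · rintro ⟨p, ⟨h1, h2⟩, rfl⟩
    exact ⟨p, h1, h2, fun x => restrictSphere_apply p x⟩

theorem IsSphericalHarmonic.sum_smul {n : ℕ} {ι : Type*} (s : Finset ι) (c : ι → ℝ)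
    {f : ι → C(Sph d, ℝ)} (hf : ∀ i, IsSphericalHarmonic n (f i)) :
    IsSphericalHarmonic n (∑ i ∈ s, c i • f i) :=
  isSphericalHarmonic_iff.2 (Submodule.sum_mem _ fun i _ =>
    Submodule.smul_mem _ _ (isSphericalHarmonic_iff.1 (hf i)))

theorem eval_aeval_eq {σ τ : Type*} (x : τ → ℝ) (g : σ → MvPolynomial τ ℝ)
    (p : MvPolynomial σ ℝ) :
    MvPolynomial.eval x (MvPolynomial.aeval g p) =
      MvPolynomial.eval (fun i => MvPolynomial.eval x (g i)) p := by
  induction p using MvPolynomial.induction_on with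
  | C a => simp
  | add p q hp hq => simp only [map_add, hp, hq]
  | mul_X p i hp => simp only [map_mul, hp, MvPolynomial.aeval_X, MvPolynomial.eval_X]

/-- The matrix of `R` in the standard basis has orthonormal rows, so substituting it into a harmonic
polynomial keeps it harmonic. -/
theorem IsSphericalHarmonic.comp_sphereMap {n : ℕ} {f : C(Sph d, ℝ)}
    (hf : IsSphericalHarmonic n f)
    (R : EuclideanSpace ℝ (Fin (d + 1)) ≃ₗᵢ[ℝ] EuclideanSpace ℝ (Fin (d + 1))) :
    IsSphericalHarmonic n (f.comp (sphereMap R)) := by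
  obtain ⟨p, hp, hp0, hfp⟩ := hf
  set b := EuclideanSpace.basisFun (Fin (d + 1)) ℝ
  set M : Fin (d + 1) → Fin (d + 1) → ℝ := fun j i => R (b i) j with hM
  have hMM : ∀ j k, ∑ i, M j i * M k i = if j = k then 1 else 0 := by
    intro j k
    have := (b.map R).sum_inner_mul_inner (b j) (b k)
    rw [b.inner_eq_ite] at this
    rw [← this]
    refine Finset.sum_congr rfl fun i _ => ?_
    simp [b, hM, EuclideanSpace.inner_single_left, EuclideanSpace.inner_single_right]
  refine ⟨MvPolynomial.aeval (fun j => linPoly (M j)) p, isHomogeneous_aeval_linPoly M hp, ?_,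
    fun x => ?_⟩
  · rw [← polyLap_apply, polyLap_aeval_linPoly M hMM, polyLap_apply, hp0, map_zero]
  · have hx : ∀ j, R (x : EuclideanSpace ℝ (Fin (d + 1))) j =
        ∑ i, M j i * (x : EuclideanSpace ℝ (Fin (d + 1))) i := by
      intro j
      conv_lhs => rw [← b.sum_repr (x : EuclideanSpace ℝ (Fin (d + 1)))]
      simp [b, hM, mul_comm]
    rw [eval_aeval_eq, ContinuousMap.comp_apply, hfp]
    simp only [linPoly, map_sum, map_mul, MvPolynomial.eval_C, MvPolynomial.eval_X, ← hx]
    rfl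

end RestrictionToSphere

/-! ### Bases of harmonics and their reproducing kernels. -/

section HarmonicSystem

variable {d : ℕ} {Y : (ℓ : ℕ) → Fin (harmonicDim d ℓ) → C(Sph d, ℝ)}

theorem IsHarmonicSystem.integralMul_eq (hY : IsHarmonicSystem Y) (n : ℕ)
    (k k' : Fin (harmonicDim d n)) :
    integralMul (Y n k) (Y n k') = if k = k' then 1 else 0 := (hY n).2 k k'

/-- The system `Y n` spans the spherical harmonics of degree `n`. -/
theorem IsHarmonicSystem.eq_sum (hd : 2 ≤ d) (hY : IsHarmonicSystem Y) {n : ℕ} {f : C(Sph d, ℝ)}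
    (hf : IsSphericalHarmonic n f) : f = ∑ k, integralMul (Y n k) f • Y n k := by
  have h := fun k => isSphericalHarmonic_iff.1 ((hY n).1 k)
  choose p hp hpY using fun k => Submodule.mem_map.1 (h k)
  obtain ⟨q, hq, hqf⟩ := Submodule.mem_map.1 (isSphericalHarmonic_iff.1 hf)
  let P : Fin (harmonicDim d n) → harmonicSubmodule (Fin (d + 1)) n := fun k => ⟨p k, hp k⟩
  have hcoef (c : Fin (harmonicDim d n) → ℝ) (j) :
      integralMul (Y n j) (∑ k, c k • Y n k) = c j := by
    simp [hY.integralMul_eq]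
  have hli : LinearIndependent ℝ P := by
    rw [Fintype.linearIndependent_iff]
    intro c hc j
    have h1 : ∑ k, c k • Y n k = 0 := by
      have := congrArg
        (fun z : harmonicSubmodule (Fin (d + 1)) n => (restrictSphere d).toLinearMap z.1) hc
      simpa [P, ← hpY] using this
    rw [← hcoef c j, h1, map_zero]
  -- Independence and the dimension bound together force the polynomials behind `Y n` to span.
  have hspan := hli.span_eq_top_of_card_eq_finrank' (le_antisymm hli.fintype_card_le_finrank
    (by simpa using finrank_harmonicSubmodule_le d n hd))
  have hmem : (⟨q, hq⟩ : harmonicSubmodule (Fin (d + 1)) n) ∈ Submodule.span ℝ (Set.range P) := by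
    rw [hspan]; trivial
  obtain ⟨c, hc⟩ := (Submodule.mem_span_range_iff_exists_fun ℝ).1 hmem
  have hfc : f = ∑ k, c k • Y n k := by
    have := congrArg
      (fun z : harmonicSubmodule (Fin (d + 1)) n => (restrictSphere d).toLinearMap z.1) hc
    rw [← hqf]
    simp only [← hpY]
    simpa [P] using this.symm
  have hc' : ∀ k, integralMul (Y n k) f = c k := fun k => by rw [hfc, hcoef]
  simp only [hc']
  exact hfc

/-- The kernel `∑ k, Y n k · Y n k z`. -/
noncomputable def harmonicKernel (Y : (ℓ : ℕ) → Fin (harmonicDim d ℓ) → C(Sph d, ℝ)) (n : ℕ)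
    (z : Sph d) : C(Sph d, ℝ) := ∑ k, Y n k z • Y n k

theorem harmonicKernel_apply (n : ℕ) (z x : Sph d) :
    harmonicKernel Y n z x = ∑ k, Y n k z * Y n k x := by
  simp [harmonicKernel]

theorem IsHarmonicSystem.isSphericalHarmonic_kernel (hY : IsHarmonicSystem Y) (n : ℕ)
    (z : Sph d) : IsSphericalHarmonic n (harmonicKernel Y n z) :=
  IsSphericalHarmonic.sum_smul _ _ (hY n).1

theorem IsHarmonicSystem.integralMul_kernel (hd : 2 ≤ d) (hY : IsHarmonicSystem Y) {n : ℕ}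
    {f : C(Sph d, ℝ)} (hf : IsSphericalHarmonic n f) (z : Sph d) :
    integralMul f (harmonicKernel Y n z) = f z := by
  conv_rhs => rw [hY.eq_sum hd hf]
  simp [harmonicKernel, fun k => integralMul_comm f (Y n k), mul_comm]

theorem integralMul_comp_sphereMap (f g : C(Sph d, ℝ))
    (R : EuclideanSpace ℝ (Fin (d + 1)) ≃ₗᵢ[ℝ] EuclideanSpace ℝ (Fin (d + 1))) :
    integralMul (f.comp (sphereMap R)) (g.comp (sphereMap R)) = integralMul f g := by
  have h := measurePreserving_sphereMap R
  have := integral_map (μ := surfaceMeasure d) (φ := sphereMap R) h.measurable.aemeasurable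
    (f := f * g) (f * g).continuous.aestronglyMeasurable
  rw [h.map_eq] at this
  exact this.symm

/-- The function `x ↦ K(Rz, Rx)` is a harmonic of degree `n`. Its coefficients are found by moving
`R` onto `Y n k` and using the reproducing property, and they are those of `K(z, ·)`. -/
theorem IsHarmonicSystem.kernel_sphereMap (hd : 2 ≤ d) (hY : IsHarmonicSystem Y) (n : ℕ)
    (R : EuclideanSpace ℝ (Fin (d + 1)) ≃ₗᵢ[ℝ] EuclideanSpace ℝ (Fin (d + 1))) (z x : Sph d) :
    harmonicKernel Y n (sphereMap R z) (sphereMap R x) = harmonicKernel Y n z x := by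
  have hh := (hY.isSphericalHarmonic_kernel n (sphereMap R z)).comp_sphereMap R
  have hRR (x) : sphereMap R (sphereMap R.symm x) = x := Subtype.ext (R.apply_symm_apply _)
  have hRR' (x) : sphereMap R.symm (sphereMap R x) = x := Subtype.ext (R.symm_apply_apply _)
  have key := hY.eq_sum hd hh
  have hc (k) : integralMul (Y n k)
      ((harmonicKernel Y n (sphereMap R z)).comp (sphereMap R)) = Y n k z := by
    have e : Y n k = ((Y n k).comp (sphereMap R.symm)).comp (sphereMap R) := by
      ext x; simp [hRR']
    conv_lhs => rw [e]
    rw [integralMul_comp_sphereMap, hY.integralMul_kernel hd (((hY n).1 k).comp_sphereMap R.symm)]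
    simp [hRR']
  have := congrArg (fun f : C(Sph d, ℝ) => f x) key
  simp only [hc] at this
  exact this

end HarmonicSystem

/-! ### The addition theorem. -/

section AdditionTheorem

variable {d : ℕ}

theorem sum_sq_coe_sphere (x : Sph d) :
    ∑ i, (x : EuclideanSpace ℝ (Fin (d + 1))) i ^ 2 = 1 := by
  rw [← EuclideanSpace.real_norm_sq_eq]; simp

/-- The function `x ↦ ⟪e, x⟫` on the sphere. -/
noncomputable def innerFn (e : Sph d) : C(Sph d, ℝ) :=
  ⟨fun x => inner ℝ (e : EuclideanSpace ℝ (Fin (d + 1))) x, by fun_prop⟩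

theorem innerFn_apply (e x : Sph d) :
    innerFn e x = inner ℝ (e : EuclideanSpace ℝ (Fin (d + 1))) x := rfl

theorem innerFn_mem_Icc (e x : Sph d) : innerFn e x ∈ Set.Icc (-1 : ℝ) 1 := by
  have := abs_real_inner_le_norm (e : EuclideanSpace ℝ (Fin (d + 1))) x
  rw [norm_eq_of_mem_sphere, norm_eq_of_mem_sphere, mul_one] at this
  exact abs_le.1 this

/-- The zonal harmonic `x ↦ P_n(⟪e, x⟫)`. -/
noncomputable def zonalFn (n : ℕ) (e : Sph d) : C(Sph d, ℝ) :=
  (gegenbauerP d n).aeval (innerFn e)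

theorem aeval_innerFn_apply (q : Polynomial ℝ) (e x : Sph d) :
    q.aeval (innerFn e) x = q.eval (innerFn e x) := by
  induction q using Polynomial.induction_on' with
  | add p q hp hq => simp [hp, hq]
  | monomial n a => simp [Polynomial.aeval_monomial]

theorem zonalFn_apply (n : ℕ) (e x : Sph d) :
    zonalFn n e x = (gegenbauerP d n).eval (inner ℝ (e : EuclideanSpace ℝ (Fin (d + 1))) x) :=
  aeval_innerFn_apply _ e x

theorem isSphericalHarmonic_zonalFn (hd : 2 ≤ d) (n : ℕ) (e : Sph d) :
    IsSphericalHarmonic n (zonalFn n e) := by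
  set e' : Fin (d + 1) → ℝ := fun i => (e : EuclideanSpace ℝ (Fin (d + 1))) i
  refine ⟨zonalPoly d e' n, zonalPoly_isHomogeneous d e' n, ?_, fun x => ?_⟩
  · rw [← polyLap_apply, polyLap_zonalPoly d hd (by simp) (sum_sq_coe_sphere e)]
  · rw [eval_zonalPoly d _ _ (sum_sq_coe_sphere x), zonalFn_apply]
    congr 1
    simp [PiLp.inner_apply, e', mul_comm]

theorem zonalFn_self (hd : 2 ≤ d) (n : ℕ) (e : Sph d) : zonalFn n e e = 1 := by
  rw [zonalFn_apply, real_inner_self_eq_norm_sq, norm_eq_of_mem_sphere, one_pow,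
    gegenbauerP_eval_one d n hd]

/-- The reflection exchanging `x` and `y` works: equal inner products put `e` in its mirror
hyperplane. -/
theorem exists_isometry_map_eq {e x y : Sph d} (h : innerFn e x = innerFn e y) :
    ∃ R : EuclideanSpace ℝ (Fin (d + 1)) ≃ₗᵢ[ℝ] EuclideanSpace ℝ (Fin (d + 1)),
      sphereMap R e = e ∧ sphereMap R x = y := by
  refine ⟨(ℝ ∙ ((x : EuclideanSpace ℝ (Fin (d + 1))) - y))ᗮ.reflection, Subtype.ext ?_,
    Subtype.ext ?_⟩
  · refine Submodule.reflection_mem_subspace_eq_self ?_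
    rw [Submodule.mem_orthogonal_singleton_iff_inner_left, inner_sub_right]
    exact sub_eq_zero.2 h
  · exact Submodule.reflection_sub (by simp)

theorem exists_isometry_map_point (x y : Sph d) :
    ∃ R : EuclideanSpace ℝ (Fin (d + 1)) ≃ₗᵢ[ℝ] EuclideanSpace ℝ (Fin (d + 1)),
      sphereMap R x = y :=
  ⟨(ℝ ∙ ((x : EuclideanSpace ℝ (Fin (d + 1))) - y))ᗮ.reflection,
    Subtype.ext (Submodule.reflection_sub (by simp))⟩

/-- A meridian through `e`. -/
theorem exists_meridian (hd : 2 ≤ d) (e : Sph d) :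
    ∃ γ : C(Set.Icc (-1 : ℝ) 1, Sph d), ∀ t, innerFn e (γ t) = t := by
  obtain ⟨w, hw, hw1⟩ : ∃ w : EuclideanSpace ℝ (Fin (d + 1)),
      inner ℝ (e : EuclideanSpace ℝ (Fin (d + 1))) w = 0 ∧ ‖w‖ = 1 := by
    have he : (e : EuclideanSpace ℝ (Fin (d + 1))) ≠ 0 := by
      rw [← norm_ne_zero_iff, norm_eq_of_mem_sphere]; norm_num
    have : Fact (Module.finrank ℝ (EuclideanSpace ℝ (Fin (d + 1))) = d + 1) := ⟨by simp⟩
    have hf := Submodule.finrank_orthogonal_span_singleton (𝕜 := ℝ) (n := d) he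
    obtain ⟨v, hv⟩ := Module.finrank_pos_iff_exists_ne_zero.1
      (show 0 < Module.finrank ℝ (ℝ ∙ (e : EuclideanSpace ℝ (Fin (d + 1))))ᗮ by omega)
    have hv0 : ‖(v : EuclideanSpace ℝ (Fin (d + 1)))‖ ≠ 0 := by simpa using hv
    refine ⟨‖(v : EuclideanSpace ℝ (Fin (d + 1)))‖⁻¹ • v, ?_, ?_⟩
    · rw [inner_smul_right, Submodule.mem_orthogonal_singleton_iff_inner_right.1 v.2, mul_zero]
    · rw [norm_smul, norm_inv, norm_norm, inv_mul_cancel₀ hv0]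
  have hee : inner ℝ (e : EuclideanSpace ℝ (Fin (d + 1))) e = (1 : ℝ) := by
    rw [real_inner_self_eq_norm_sq, norm_eq_of_mem_sphere, one_pow]
  have hmem (t : Set.Icc (-1 : ℝ) 1) : (t : ℝ) • (e : EuclideanSpace ℝ (Fin (d + 1))) +
      √(1 - (t : ℝ) ^ 2) • w ∈ Metric.sphere (0 : EuclideanSpace ℝ (Fin (d + 1))) 1 := by
    have ht : 0 ≤ 1 - (t : ℝ) ^ 2 := by nlinarith [t.2.1, t.2.2]
    rw [mem_sphere_zero_iff_norm, ← sq_eq_sq₀ (norm_nonneg _) zero_le_one, one_pow,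
      norm_add_sq_real, norm_smul, norm_smul, inner_smul_left, inner_smul_right, hw, hw1,
      norm_eq_of_mem_sphere, mul_one, mul_one, Real.norm_eq_abs, Real.norm_eq_abs, sq_abs, sq_abs,
      Real.sq_sqrt ht]
    ring
  refine ⟨⟨fun t => ⟨_, hmem t⟩, Continuous.subtype_mk (by fun_prop) hmem⟩, fun t => ?_⟩
  simp only [innerFn_apply, ContinuousMap.coe_mk, inner_add_right, inner_smul_right, hw, hee]
  ring

/-- Each `gegenbauerP d n` has exact degree `n`, so leading terms can be removed one degree at a
time. -/
theorem integralMul_aeval_eq_zero (hd : 2 ≤ d) {e : Sph d} {G : C(Sph d, ℝ)}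
    (h : ∀ n, integralMul G (zonalFn n e) = 0) (q : Polynomial ℝ) :
    integralMul G (q.aeval (innerFn e)) = 0 := by
  suffices H : ∀ n : ℕ, ∀ q : Polynomial ℝ, q.degree < n →
      integralMul G (q.aeval (innerFn e)) = 0 from
    H (q.natDegree + 1) q (Polynomial.degree_le_natDegree.trans_lt
      (by exact_mod_cast q.natDegree.lt_succ_self))
  intro n
  induction n with
  | zero =>
    intro q hq
    have : q = 0 := by simpa using hq
    simp [this]
  | succ n ih =>
    intro q hq
    set P := gegenbauerP d n with hP
    have hPd : P.natDegree = n := gegenbauerP_natDegree d n hd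
    have hP0 : P.coeff n ≠ 0 := by
      have : P ≠ 0 := fun h0 => by
        have := gegenbauerP_eval_one d n hd
        rw [← hP, h0] at this
        simp at this
      rw [← hPd]
      exact Polynomial.leadingCoeff_ne_zero.2 this
    set c := q.coeff n / P.coeff n
    have hlt : (q - c • P).degree < n := by
      rw [Polynomial.degree_lt_iff_coeff_zero] at hq ⊢
      intro m hm
      rcases hm.eq_or_lt with rfl | hm
      · simp [c, div_mul_cancel₀ _ hP0]
      · rw [Polynomial.coeff_sub, Polynomial.coeff_smul, hq m hm,
          Polynomial.coeff_eq_zero_of_natDegree_lt (by omega)]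
        simp
    have h1 := ih _ hlt
    rw [map_sub, map_sub, map_smul, map_smul] at h1
    have h2 := h n
    rw [zonalFn, ← hP] at h2
    rwa [h2, smul_zero, sub_zero] at h1

theorem abs_integralMul_le (f g : C(Sph d, ℝ)) {c : ℝ} (hg : ∀ x, |g x| ≤ c) :
    |integralMul f g| ≤ c * ∫ x, |f x| ∂(surfaceMeasure d) := by
  rw [integralMul_apply, ← integral_const_mul]
  refine abs_integral_le_integral_abs.trans (integral_mono
    (integrable_continuousMap (f * g)).abs ((integrable_continuousMap f).abs.const_mul c)
    fun x => ?_)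
  dsimp only
  rw [abs_mul, mul_comm]
  exact mul_le_mul_of_nonneg_right (hg x) (abs_nonneg _)

/-- A continuous function invariant under the stabilizer of `e` and orthogonal to all zonal
harmonics with pole `e` vanishes. -/
theorem eq_zero_of_zonal (hd : 2 ≤ d) {e : Sph d} {G : C(Sph d, ℝ)}
    (hG : ∀ R : EuclideanSpace ℝ (Fin (d + 1)) ≃ₗᵢ[ℝ] EuclideanSpace ℝ (Fin (d + 1)),
      sphereMap R e = e → ∀ x, G (sphereMap R x) = G x)
    (h : ∀ n, integralMul G (zonalFn n e) = 0) : G = 0 := by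
  obtain ⟨γ, hγ⟩ := exists_meridian hd e
  -- Invariance makes `G` a function of `⟪e, x⟫` only, with profile `G ∘ γ`.
  have hGγ : ∀ x, G x = G (γ ⟨innerFn e x, innerFn_mem_Icc e x⟩) := by
    intro x
    obtain ⟨R, hRe, hRx⟩ := exists_isometry_map_eq
      (e := e) (x := x) (y := γ ⟨innerFn e x, innerFn_mem_Icc e x⟩)
      (hγ ⟨innerFn e x, innerFn_mem_Icc e x⟩).symm
    rw [← hRx, hG R hRe]
  apply eq_zero_of_integralMul_self
  have hI : 0 ≤ ∫ x, |G x| ∂(surfaceMeasure d) := integral_nonneg fun x => abs_nonneg _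
  have hle : ∀ ε > 0, |integralMul G G| ≤ ε * ∫ x, |G x| ∂(surfaceMeasure d) := by
    intro ε hε
    -- A polynomial close to the profile is orthogonal to `G`, so subtracting it from the second
    -- factor costs nothing and leaves a factor of size `ε`.
    obtain ⟨q, hq⟩ := exists_polynomial_near_continuousMap (-1) 1 (G.comp γ) ε hε
    have : integralMul G G = integralMul G (G - q.aeval (innerFn e)) := by
      rw [map_sub, integralMul_aeval_eq_zero hd h, sub_zero]
    rw [this]
    refine abs_integralMul_le _ _ fun x => ?_
    have h1 := (ContinuousMap.norm_coe_le_norm _ ⟨innerFn e x, innerFn_mem_Icc e x⟩).trans hq.le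
    rw [ContinuousMap.sub_apply, aeval_innerFn_apply, hGγ x, abs_sub_comm]
    simpa using h1
  by_contra hne
  have hpos : 0 < |integralMul G G| := abs_pos.2 hne
  set I := ∫ x, |G x| ∂(surfaceMeasure d)
  -- The bound becomes less than `|integralMul G G|` itself; the `+ 1` covers `I = 0`.
  have h2 := hle (|integralMul G G| / (2 * (I + 1))) (by positivity)
  rw [div_mul_eq_mul_div, le_div_iff₀ (by positivity)] at h2
  nlinarith

variable {Y : (ℓ : ℕ) → Fin (harmonicDim d ℓ) → C(Sph d, ℝ)}

/-- Subtract from the kernel its projection onto the zonal function. The difference is invariant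
about `e` and orthogonal to zonal harmonics of every degree, so `eq_zero_of_zonal` applies;
evaluating at `e` identifies the factor. -/
theorem IsHarmonicSystem.kernel_eq_smul_zonalFn (hd : 2 ≤ d) (hY : IsHarmonicSystem Y) (n : ℕ)
    (e : Sph d) : harmonicKernel Y n e = harmonicKernel Y n e e • zonalFn n e := by
  set K := harmonicKernel Y n e
  set ψ := zonalFn n e with hψ
  have hψψ : integralMul ψ ψ ≠ 0 := fun h => by
    have h1 := zonalFn_self hd n e
    rw [← hψ, eq_zero_of_integralMul_self h] at h1
    simp at h1
  set c := integralMul K ψ / integralMul ψ ψ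
  have hKc : K - c • ψ = 0 := by
    refine eq_zero_of_zonal hd (e := e) (fun R hR x => ?_) fun m => ?_
    · have h1 := hY.kernel_sphereMap hd n R e x
      rw [hR] at h1
      have h2 : ψ (sphereMap R x) = ψ x := by
        rw [hψ, zonalFn_apply, zonalFn_apply]
        congr 1
        have : (e : EuclideanSpace ℝ (Fin (d + 1))) = R e := congrArg Subtype.val hR.symm
        conv_lhs => rw [this]
        exact R.inner_map_map _ _
      simp only [ContinuousMap.sub_apply, ContinuousMap.smul_apply, h2]
      rw [h1]
    · rw [integralMul_comm, map_sub, map_smul, integralMul_comm _ K, integralMul_comm _ ψ]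
      rcases eq_or_ne m n with rfl | hmn
      · rw [smul_eq_mul, ← hψ, div_mul_cancel₀ _ hψψ, sub_self]
      · have hm := isSphericalHarmonic_zonalFn hd m e
        rw [integralMul_apply, integralMul_apply, integral_harmonic_mul_harmonic hmn.symm
          (hY.isSphericalHarmonic_kernel n e) hm, integral_harmonic_mul_harmonic hmn.symm
          (isSphericalHarmonic_zonalFn hd n e) hm, smul_zero, sub_zero]
  have hK := sub_eq_zero.1 hKc
  have : K e = c := by
    rw [hK, ContinuousMap.smul_apply, hψ, zonalFn_self hd, smul_eq_mul, mul_one]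
  rw [this]
  exact hK

/-- The diagonal is constant since isometries act transitively, and its integral counts the
normalized basis functions. -/
theorem IsHarmonicSystem.kernel_self (hd : 2 ≤ d) (hY : IsHarmonicSystem Y) (n : ℕ)
    (e : Sph d) : harmonicKernel Y n e e = harmonicDim d n := by
  have h1 : ∀ x, harmonicKernel Y n x x = harmonicKernel Y n e e := by
    intro x
    obtain ⟨R, hR⟩ := exists_isometry_map_point e x
    rw [← hR, hY.kernel_sphereMap hd]
  have h2 : ∫ x, harmonicKernel Y n x x ∂(surfaceMeasure d) = harmonicDim d n := by
    simp only [harmonicKernel_apply]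
    refine (integral_finsetSum _ fun k _ => integrable_continuousMap (Y n k * Y n k)).trans ?_
    simp [(hY n).2]
  simpa [h1] using h2

/-- The addition theorem for spherical harmonics. -/
theorem IsHarmonicSystem.addition_theorem (hd : 2 ≤ d) (hY : IsHarmonicSystem Y) (n : ℕ)
    (x y : Sph d) : ∑ k, Y n k x * Y n k y = harmonicDim d n *
      (gegenbauerP d n).eval (inner ℝ (x : EuclideanSpace ℝ (Fin (d + 1))) y) := by
  rw [← harmonicKernel_apply, hY.kernel_eq_smul_zonalFn hd, hY.kernel_self hd,
    ContinuousMap.smul_apply, zonalFn_apply, smul_eq_mul]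

theorem IsHarmonicSystem.sum_sq (hd : 2 ≤ d) (hY : IsHarmonicSystem Y) (n : ℕ) (x : Sph d) :
    ∑ k, Y n k x ^ 2 = harmonicDim d n := by
  rw [← hY.kernel_self hd n x, harmonicKernel_apply]
  simp only [sq]

end AdditionTheorem

/-! ### Completeness of the harmonics. -/

section Completeness

variable {d : ℕ} {Y : (ℓ : ℕ) → Fin (harmonicDim d ℓ) → C(Sph d, ℝ)}

theorem restrictSphere_normSqPoly : restrictSphere d (normSqPoly (Fin (d + 1))) = 1 := by
  ext x
  simp [restrictSphere_apply, normSqPoly, sum_sq_coe_sphere]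

/-- Since `|x|² = 1` on the sphere, splitting off the harmonic part of a homogeneous polynomial
leaves one of degree two less. -/
theorem restrictSphere_mem_of_harmonic (W : Submodule ℝ C(Sph d, ℝ))
    (hW : ∀ n f, IsSphericalHarmonic n f → f ∈ W) (p : MvPolynomial (Fin (d + 1)) ℝ) :
    restrictSphere d p ∈ W := by
  have key : ∀ n, ∀ p : MvPolynomial (Fin (d + 1)) ℝ, p.IsHomogeneous n →
      restrictSphere d p ∈ W := by
    intro n
    induction n using Nat.twoStepInduction with
    | zero | one =>
      intro p hp
      exact hW _ _ (isSphericalHarmonic_iff.2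
        ⟨p, ⟨hp, polyLap_eq_zero_of_lt_two (by norm_num) hp⟩, rfl⟩)
    | more n h0 _ =>
      intro p hp
      obtain ⟨h, q, hh, hh0, hq, rfl⟩ := exists_harmonic_add_normSqPoly_mul hp
      rw [map_add, map_mul, restrictSphere_normSqPoly, one_mul]
      exact W.add_mem (hW _ _ (isSphericalHarmonic_iff.2 ⟨h, ⟨hh, hh0⟩, rfl⟩)) (h0 q hq)
  rw [← p.sum_homogeneousComponent, map_sum]
  exact W.sum_mem fun n _ => key n _ (MvPolynomial.homogeneousComponent_isHomogeneous n p)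

theorem denseRange_restrictSphere : DenseRange (restrictSphere d) := by
  have h := ContinuousMap.subalgebra_topologicalClosure_eq_top_of_separatesPoints
    (restrictSphere d).range (fun x y hxy => by
      obtain ⟨i, hi⟩ : ∃ i, (x : EuclideanSpace ℝ (Fin (d + 1))) i ≠
          (y : EuclideanSpace ℝ (Fin (d + 1))) i := by
        by_contra! hc
        exact hxy (Subtype.ext (PiLp.ext hc))
      exact ⟨_, ⟨_, ⟨MvPolynomial.X i, rfl⟩, rfl⟩, by simpa [restrictSphere_apply] using hi⟩)
  intro f
  have : f ∈ (restrictSphere d).range.topologicalClosure := by rw [h]; trivial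
  exact this

/-- The functional `⟪f, ·⟫` kills all harmonics, hence restricted polynomials, hence by two density
steps continuous functions and all of `L₂`. -/
theorem IsHarmonicSystem.eq_zero_of_fourierCoeffSph (hd : 2 ≤ d) (hY : IsHarmonicSystem Y)
    {f : Lp ℝ 2 (surfaceMeasure d)} (hf : ∀ ℓ k, fourierCoeffSph Y f ℓ k = 0) : f = 0 := by
  have hin (g : C(Sph d, ℝ)) : inner ℝ f (toL2 g) = ∫ x, f x * g x ∂(surfaceMeasure d) := by
    rw [L2.inner_def]
    refine integral_congr_ae ?_
    filter_upwards [ContinuousMap.coeFn_toLp (p := 2) (𝕜 := ℝ) (surfaceMeasure d) g] with x hx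
    rw [toL2, hx]
    simp [mul_comm]
  let Φ : C(Sph d, ℝ) →L[ℝ] ℝ :=
    (innerSL ℝ f).comp (ContinuousMap.toLp 2 (surfaceMeasure d) ℝ)
  have hΦ (g) : Φ g = inner ℝ f (toL2 g) := rfl
  have hΦ0 : ∀ p, Φ (restrictSphere d p) = 0 := by
    refine restrictSphere_mem_of_harmonic (LinearMap.ker Φ.toLinearMap) fun n g hg => ?_
    rw [hY.eq_sum hd hg]
    refine Submodule.sum_mem _ fun k _ => Submodule.smul_mem _ _ ?_
    exact (hin _).trans (hf n k)
  have hΦ1 : ∀ g, Φ g = 0 := by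
    intro g
    have := Continuous.ext_on denseRange_restrictSphere Φ.continuous
      (continuous_const (y := (0 : ℝ))) (by rintro _ ⟨p, rfl⟩; exact hΦ0 p)
    exact congrFun this g
  have hdense : DenseRange (ContinuousMap.toLp 2 (surfaceMeasure d) ℝ : C(Sph d, ℝ) →L[ℝ] _) :=
    ContinuousMap.toLp_denseRange ℝ (surfaceMeasure d) ℝ (by norm_num)
  have : ∀ h : Lp ℝ 2 (surfaceMeasure d), inner ℝ f h = 0 := by
    intro h
    have := Continuous.ext_on hdense (innerSL ℝ f).continuous
      (continuous_const (y := (0 : ℝ))) (by rintro _ ⟨g, rfl⟩; exact hΦ1 g)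
    exact congrFun this h
  exact inner_self_eq_zero.1 (this f)

end Completeness

/-! ### Growth of dimensions and comparison of weights. -/

section Estimates

variable {d : ℕ}

theorem eigenvalue_ge_sq (hd : 2 ≤ d) (ℓ : ℕ) : (ℓ : ℝ) ^ 2 ≤ eigenvalue d ℓ := by
  have hd' : (2 : ℝ) ≤ d := by exact_mod_cast hd
  unfold eigenvalue
  nlinarith [(Nat.cast_nonneg ℓ : (0 : ℝ) ≤ ℓ)]

theorem one_add_eigenvalue_pos (hd : 2 ≤ d) (ℓ : ℕ) : 0 < 1 + eigenvalue d ℓ := by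
  linarith [eigenvalue_ge_sq hd ℓ, sq_nonneg (ℓ : ℝ)]

theorem harmonicDim_le (hd : 2 ≤ d) {n : ℕ} (hn : 1 ≤ n) :
    harmonicDim d n ≤ 2 * (d + 1) ^ (d - 1) * n ^ (d - 1) := by
  obtain ⟨e, rfl⟩ := Nat.exists_eq_add_of_le' hd
  rw [show e + 2 - 1 = e + 1 by omega]
  have h1 : (n + e).factorial ≤ n.factorial * (n + e) ^ e := by
    rw [← Nat.factorial_mul_ascFactorial]
    exact Nat.mul_le_mul_left _ (Nat.ascFactorial_le_pow_add n e)
  have h2 : n + (e + 2) ≤ (e + 2 + 1) * n := by nlinarith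
  unfold harmonicDim
  refine Nat.div_le_of_le_mul ?_
  rw [show 2 * n + (e + 2) - 1 = 2 * n + e + 1 by omega, show n + (e + 2) - 2 = n + e by omega,
    show e + 2 - 1 = e + 1 by omega]
  calc (2 * n + e + 1) * (n + e).factorial
      ≤ (2 * (n + (e + 2))) * (n.factorial * (n + (e + 2)) ^ e) := by
        refine Nat.mul_le_mul (by omega) (h1.trans (Nat.mul_le_mul_left _ ?_))
        exact Nat.pow_le_pow_left (by omega) _
    _ = n.factorial * (2 * (n + (e + 2)) ^ (e + 1)) := by ring
    _ ≤ n.factorial * (2 * ((e + 2 + 1) * n) ^ (e + 1)) :=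
        Nat.mul_le_mul_left _ (Nat.mul_le_mul_left _ (Nat.pow_le_pow_left h2 _))
    _ ≤ ((e + 1).factorial * n.factorial) * (2 * ((e + 2 + 1) * n) ^ (e + 1)) :=
        Nat.mul_le_mul_right _ (Nat.le_mul_of_pos_left _ (Nat.factorial_pos _))
    _ = _ := by rw [mul_pow]; ring

/-- The terms are `O(n^(d - 1 - 2s))`, and `s > d / 2` puts the exponent below `-1`. Degree zero is
split off since the power bounds need `n ≥ 1`. -/
theorem summable_harmonicDim_mul (hd : 2 ≤ d) {s : ℝ} (hs : (d : ℝ) / 2 < s) :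
    Summable fun ℓ : ℕ => (1 + eigenvalue d ℓ) ^ (-s) * harmonicDim d ℓ := by
  have hd' : (2 : ℝ) ≤ d := by exact_mod_cast hd
  rw [← summable_nat_add_iff 1]
  have hsum : Summable fun n : ℕ => ((n : ℝ)) ^ ((d : ℝ) - 1 - 2 * s) :=
    Real.summable_nat_rpow.2 (by linarith)
  refine Summable.of_nonneg_of_le (fun n => ?_) (fun n => ?_)
    (((summable_nat_add_iff 1).2 hsum).mul_left (2 * ((d : ℝ) + 1) ^ (d - 1)))
  · have := (one_add_eigenvalue_pos hd (n + 1)).le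
    positivity
  · have hn : (0 : ℝ) < ((n + 1 : ℕ) : ℝ) := by positivity
    have h1 : (1 + eigenvalue d (n + 1)) ^ (-s) ≤ ((n + 1 : ℕ) : ℝ) ^ (-(2 * s)) := by
      rw [show -(2 * s) = 2 * -s by ring, Real.rpow_mul hn.le]
      refine Real.rpow_le_rpow_of_nonpos (by positivity) ?_ (by linarith)
      rw [Real.rpow_two]
      linarith [eigenvalue_ge_sq hd (n + 1)]
    have h2 : (harmonicDim d (n + 1) : ℝ) ≤
        2 * ((d : ℝ) + 1) ^ (d - 1) * ((n + 1 : ℕ) : ℝ) ^ (d - 1) := by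
      exact_mod_cast harmonicDim_le hd (Nat.le_add_left 1 n)
    have h3 : ((n + 1 : ℕ) : ℝ) ^ ((d : ℝ) - 1 - 2 * s) =
        ((n + 1 : ℕ) : ℝ) ^ (d - 1) * ((n + 1 : ℕ) : ℝ) ^ (-(2 * s)) := by
      rw [← Real.rpow_natCast _ (d - 1), ← Real.rpow_add hn, Nat.cast_sub (by omega), Nat.cast_one]
      ring_nf
    rw [h3]
    calc _ ≤ ((n + 1 : ℕ) : ℝ) ^ (-(2 * s)) *
          (2 * ((d : ℝ) + 1) ^ (d - 1) * ((n + 1 : ℕ) : ℝ) ^ (d - 1)) :=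
          mul_le_mul h1 h2 (by positivity) (by positivity)
      _ = _ := by ring

theorem summable_mul_harmonicDim (hd : 2 ≤ d) {s : ℝ} (hs : (d : ℝ) / 2 < s) {a : ℕ → ℝ}
    (ha : ∀ ℓ, 0 < a ℓ) (hcomp : Comparable (fun ℓ => (1 + eigenvalue d ℓ) ^ (-s)) a) :
    Summable fun ℓ : ℕ => a ℓ * harmonicDim d ℓ := by
  obtain ⟨c₁, c₂, -, -, h⟩ := hcomp
  refine Summable.of_nonneg_of_le (fun ℓ => by have := ha ℓ; positivity) (fun ℓ => ?_)
    ((summable_harmonicDim_mul hd hs).mul_left c₂)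
  rw [← mul_assoc]
  exact mul_le_mul_of_nonneg_right (h ℓ).2 (Nat.cast_nonneg _)

theorem mem_sobolevSpace_iff (hd : 2 ≤ d) {Y : (ℓ : ℕ) → Fin (harmonicDim d ℓ) → C(Sph d, ℝ)}
    {s : ℝ} {a : ℕ → ℝ} (ha : ∀ ℓ, 0 < a ℓ)
    (hcomp : Comparable (fun ℓ => (1 + eigenvalue d ℓ) ^ (-s)) a)
    {f : Lp ℝ 2 (surfaceMeasure d)} :
    f ∈ sobolevSpace Y s ↔
      Summable fun ℓ => ∑ k, 1 / a ℓ * |fourierCoeffSph Y f ℓ k| ^ 2 := by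
  change (Summable fun ℓ => ∑ k, (1 + eigenvalue d ℓ) ^ s * |fourierCoeffSph Y f ℓ k| ^ 2) ↔ _
  obtain ⟨c₁, c₂, hc₁, hc₂, h⟩ := hcomp
  have hp (ℓ) : 0 < (1 + eigenvalue d ℓ) ^ s := Real.rpow_pos_of_pos (one_add_eigenvalue_pos hd ℓ) s
  have hinv (ℓ) : (1 + eigenvalue d ℓ) ^ (-s) = ((1 + eigenvalue d ℓ) ^ s)⁻¹ :=
    Real.rpow_neg (one_add_eigenvalue_pos hd ℓ).le s
  simp only [hinv] at h
  simp only [← Finset.mul_sum]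
  have hS (ℓ) : 0 ≤ ∑ k, |fourierCoeffSph Y f ℓ k| ^ 2 := Finset.sum_nonneg fun k _ => sq_nonneg _
  constructor <;> intro hf
  · refine Summable.of_nonneg_of_le (fun ℓ => mul_nonneg (one_div_pos.2 (ha ℓ)).le (hS ℓ))
      (fun ℓ => ?_) (hf.mul_left (1 / c₁))
    rw [← mul_assoc]
    refine mul_le_mul_of_nonneg_right ?_ (hS ℓ)
    have := (h ℓ).1
    rw [← div_eq_mul_inv, div_le_iff₀ (hp ℓ)] at this
    rw [div_mul_eq_mul_div, one_mul, div_le_div_iff₀ (ha ℓ) hc₁]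
    linarith
  · refine Summable.of_nonneg_of_le (fun ℓ => mul_nonneg (hp ℓ).le (hS ℓ))
      (fun ℓ => ?_) (hf.mul_left c₂)
    rw [← mul_assoc]
    refine mul_le_mul_of_nonneg_right ?_ (hS ℓ)
    have := (h ℓ).2
    rw [← div_eq_mul_inv, le_div_iff₀ (hp ℓ)] at this
    rw [mul_one_div, le_div_iff₀ (ha ℓ)]
    linarith

end Estimates

/-! ### Kernel convergence and continuous representatives. -/

section SobolevFunctions

variable {d : ℕ} {Y : (ℓ : ℕ) → Fin (harmonicDim d ℓ) → C(Sph d, ℝ)}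

/-- A meridian realizes `t` as an inner product. The addition theorem and `|uv| ≤ (u² + v²) / 2`
then bound the value by the kernel's diagonal. -/
theorem IsHarmonicSystem.abs_harmonicDim_mul_gegenbauerP_le (hd : 2 ≤ d)
    (hY : IsHarmonicSystem Y) (n : ℕ) {t : ℝ} (ht : t ∈ Set.Icc (-1 : ℝ) 1) :
    |harmonicDim d n * (gegenbauerP d n).eval t| ≤ harmonicDim d n := by
  set e : Sph d := ⟨EuclideanSpace.single 0 1, by simp⟩
  obtain ⟨γ, hγ⟩ := exists_meridian hd e
  have h := hY.addition_theorem hd n e (γ ⟨t, ht⟩)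
  rw [← innerFn_apply, hγ] at h
  rw [← h]
  have h1 := hY.sum_sq hd n e
  have h2 := hY.sum_sq hd n (γ ⟨t, ht⟩)
  calc |∑ k, Y n k e * Y n k (γ ⟨t, ht⟩)| ≤ ∑ k, |Y n k e * Y n k (γ ⟨t, ht⟩)| :=
        Finset.abs_sum_le_sum_abs _ _
    _ ≤ ∑ k, (1 / 2 * Y n k e ^ 2 + 1 / 2 * Y n k (γ ⟨t, ht⟩) ^ 2) := by
        refine Finset.sum_le_sum fun k _ => ?_
        rw [abs_le]
        constructor <;> nlinarith [sq_nonneg (Y n k e + Y n k (γ ⟨t, ht⟩)),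
          sq_nonneg (Y n k e - Y n k (γ ⟨t, ht⟩))]
    _ = harmonicDim d n := by
        rw [Finset.sum_add_distrib, ← Finset.mul_sum, ← Finset.mul_sum, h1, h2]; ring

theorem IsHarmonicSystem.summable_kernelTerm (hd : 2 ≤ d) (hY : IsHarmonicSystem Y) {a : ℕ → ℝ}
    (ha : ∀ ℓ, 0 < a ℓ) (hsum : Summable fun ℓ : ℕ => a ℓ * harmonicDim d ℓ) {t : ℝ}
    (ht : t ∈ Set.Icc (-1 : ℝ) 1) : Summable fun ℓ : ℕ => kernelTerm d a t (ℓ + 1) := by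
  refine (summable_nat_add_iff 1).2 (Summable.of_norm_bounded hsum fun ℓ => ?_)
  rw [kernelTerm, mul_assoc, Real.norm_eq_abs, abs_mul, abs_of_pos (ha ℓ)]
  exact mul_le_mul_of_nonneg_left (hY.abs_harmonicDim_mul_gegenbauerP_le hd ℓ ht) (ha ℓ).le

theorem continuous_integralMul (f : C(Sph d, ℝ)) : Continuous (integralMul f) := by
  refine AddMonoidHomClass.continuous_of_bound (integralMul f)
    (∫ x, |f x| ∂(surfaceMeasure d)) fun g => ?_
  rw [mul_comm]
  exact abs_integralMul_le f g fun x => g.norm_coe_le_norm x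

theorem toL2_ae_eq (g : C(Sph d, ℝ)) : toL2 g =ᵐ[surfaceMeasure d] g :=
  ContinuousMap.coeFn_toLp (p := 2) (𝕜 := ℝ) (surfaceMeasure d) g

theorem toL2_injective : Function.Injective (toL2 (d := d)) := by
  intro f g h
  have h1 : f =ᵐ[surfaceMeasure d] g := by
    filter_upwards [toL2_ae_eq f, toL2_ae_eq g] with x hf hg
    rw [← hf, ← hg, h]
  exact DFunLike.coe_injective
    ((Continuous.ae_eq_iff_eq (surfaceMeasure d) f.continuous g.continuous).1 h1)

theorem fourierCoeffSph_toL2 (g : C(Sph d, ℝ)) (ℓ : ℕ) (k : Fin (harmonicDim d ℓ)) :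
    fourierCoeffSph Y (toL2 g) ℓ k = integralMul (Y ℓ k) g := by
  refine integral_congr_ae ?_
  filter_upwards [toL2_ae_eq g] with x hx
  rw [hx, mul_comm]

/-- Pointwise `|c||Y| ≤ c² / α + α Y²`, and the squares `Y²` sum to the dimension. With `α = a ℓ`
both terms are summable, giving sup-norm convergence. -/
theorem IsHarmonicSystem.norm_sum_smul_le (hd : 2 ≤ d) (hY : IsHarmonicSystem Y) (n : ℕ)
    (c : Fin (harmonicDim d n) → ℝ) {α : ℝ} (hα : 0 < α) :
    ‖∑ k, c k • Y n k‖ ≤ ∑ k, 1 / α * |c k| ^ 2 + α * harmonicDim d n := by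
  have h0 : 0 ≤ ∑ k, 1 / α * |c k| ^ 2 + α * harmonicDim d n := by positivity
  rw [ContinuousMap.norm_le _ h0]
  intro x
  rw [← hY.sum_sq hd n x, Finset.mul_sum, ← Finset.sum_add_distrib, ContinuousMap.sum_apply]
  refine (norm_sum_le _ _).trans (Finset.sum_le_sum fun k _ => ?_)
  rw [ContinuousMap.smul_apply, smul_eq_mul, Real.norm_eq_abs, abs_mul, ← sq_abs (Y n k x)]
  set u := |c k|
  set v := |Y n k x|
  have : 1 / α * u ^ 2 + α * v ^ 2 - u * v = 1 / α * ((u - α * v / 2) ^ 2 + 3 / 4 * (α * v) ^ 2) := by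
    field_simp
    ring
  have h2 : 0 ≤ 1 / α * ((u - α * v / 2) ^ 2 + 3 / 4 * (α * v) ^ 2) := by positivity
  linarith

/-- Square summable weighted coefficients are those of a continuous function. -/
theorem IsHarmonicSystem.exists_hasSum (hd : 2 ≤ d) (hY : IsHarmonicSystem Y) {a : ℕ → ℝ}
    (ha : ∀ ℓ, 0 < a ℓ) (hsum : Summable fun ℓ : ℕ => a ℓ * harmonicDim d ℓ)
    (c : (ℓ : ℕ) → Fin (harmonicDim d ℓ) → ℝ)
    (hc : Summable fun ℓ => ∑ k, 1 / a ℓ * |c ℓ k| ^ 2) :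
    ∃ g : C(Sph d, ℝ), HasSum (fun ℓ => ∑ k, c ℓ k • Y ℓ k) g ∧
      ∀ ℓ k, integralMul (Y ℓ k) g = c ℓ k := by
  have hs : Summable fun ℓ => ∑ k, c ℓ k • Y ℓ k :=
    Summable.of_norm_bounded (hc.add hsum) fun ℓ => hY.norm_sum_smul_le hd ℓ (c ℓ) (ha ℓ)
  refine ⟨_, hs.hasSum, fun m j => ?_⟩
  have h1 := hs.hasSum.map (integralMul (Y m j)) (continuous_integralMul _)
  have h2 : HasSum (integralMul (Y m j) ∘ fun ℓ => ∑ k, c ℓ k • Y ℓ k) (c m j) := by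
    have h3 : (integralMul (Y m j) ∘ fun ℓ => ∑ k, c ℓ k • Y ℓ k) m = c m j := by
      simp [hY.integralMul_eq]
    rw [← h3]
    refine hasSum_single m fun ℓ hℓ => ?_
    rw [Function.comp_apply, map_sum]
    refine Finset.sum_eq_zero fun k _ => ?_
    rw [map_smul, integralMul_apply, integral_harmonic_mul_harmonic hℓ.symm ((hY m).1 j)
      ((hY ℓ).1 k), smul_zero]
  exact h1.unique h2

theorem IsHarmonicSystem.hasSum_of_mem_sobolev (hd : 2 ≤ d) (hY : IsHarmonicSystem Y) {a : ℕ → ℝ}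
    (ha : ∀ ℓ, 0 < a ℓ) (hsum : Summable fun ℓ : ℕ => a ℓ * harmonicDim d ℓ)
    {f : Lp ℝ 2 (surfaceMeasure d)}
    (hf : Summable fun ℓ => ∑ k, 1 / a ℓ * |fourierCoeffSph Y f ℓ k| ^ 2) :
    ∃ g : C(Sph d, ℝ), toL2 g = f ∧ HasSum (fun ℓ => ∑ k, fourierCoeffSph Y f ℓ k • Y ℓ k) g := by
  obtain ⟨g, hg, hgc⟩ := hY.exists_hasSum hd ha hsum _ hf
  refine ⟨g, ?_, hg⟩
  have h0 := hY.eq_zero_of_fourierCoeffSph hd (f := toL2 g + (-1 : ℝ) • f) fun ℓ k => by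
    rw [fourierCoeffSph_add, fourierCoeffSph_smul, fourierCoeffSph_toL2, hgc]
    ring
  rw [neg_one_smul] at h0
  exact add_neg_eq_zero.1 h0

end SobolevFunctions

/-! ### The error functional, its bound and an extremal function. -/

section WorstCaseError

variable {d : ℕ} {Y : (ℓ : ℕ) → Fin (harmonicDim d ℓ) → C(Sph d, ℝ)}

/-- The mean `N⁻¹ ∑ j, Y_{ℓ,k}(x_j)`. -/
noncomputable def nodeMean {N : ℕ} (Y : (ℓ : ℕ) → Fin (harmonicDim d ℓ) → C(Sph d, ℝ))
    (x : Fin N → Sph d) (ℓ : ℕ) (k : Fin (harmonicDim d ℓ)) : ℝ :=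
  1 / (N : ℝ) * ∑ j, Y ℓ k (x j)

/-- By the addition theorem the kernel of degree zero is the constant `1`. -/
theorem IsHarmonicSystem.sum_integralMul_mul_zero (hd : 2 ≤ d) (hY : IsHarmonicSystem Y)
    (g : C(Sph d, ℝ)) (x : Sph d) : ∑ k, integralMul (Y 0 k) g * Y 0 k x = exactIntegral g := by
  have hZ : harmonicDim d 0 = 1 := by
    obtain ⟨e, rfl⟩ := Nat.exists_eq_add_of_le' hd
    simp [harmonicDim, Nat.factorial_succ, Nat.div_self, Nat.factorial_pos]
  have hK : harmonicKernel Y 0 x = 1 := by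
    ext y
    rw [harmonicKernel_apply, hY.addition_theorem hd, hZ]
    simp [gegenbauerP]
  have : integralMul g (harmonicKernel Y 0 x) = exactIntegral g := by
    rw [hK, integralMul_apply]
    simp [exactIntegral]
  rw [← this]
  simp [harmonicKernel, fun k => integralMul_comm g (Y 0 k), mul_comm]

theorem IsHarmonicSystem.hasSum_error (hd : 2 ≤ d) (hY : IsHarmonicSystem Y) {N : ℕ} (hN : 0 < N)
    (x : Fin N → Sph d) {g : C(Sph d, ℝ)}
    (hg : HasSum (fun ℓ => ∑ k, integralMul (Y ℓ k) g • Y ℓ k) g) :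
    HasSum (fun ℓ => ∑ k, integralMul (Y (ℓ + 1) k) g * nodeMean Y x (ℓ + 1) k)
      (equalWeightRule x g - exactIntegral g) := by
  have h1 (j : Fin N) : HasSum (fun ℓ => ∑ k, integralMul (Y ℓ k) g * Y ℓ k (x j)) (g (x j)) := by
    have := hg.map (ContinuousMap.evalCLM ℝ (x j)) (ContinuousMap.evalCLM ℝ (x j)).continuous
    simpa [Function.comp_def] using this
  have h2 : HasSum (fun ℓ => ∑ k, integralMul (Y ℓ k) g * nodeMean Y x ℓ k)
      (equalWeightRule x g) := by
    have h := (hasSum_sum fun j (_ : j ∈ Finset.univ) => h1 j).mul_left (1 / (N : ℝ))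
    refine h.congr_fun fun ℓ => ?_
    simp only [nodeMean, Finset.mul_sum]
    rw [Finset.sum_comm]
    exact Finset.sum_congr rfl fun j _ => Finset.sum_congr rfl fun k _ => by ring
  have h0 : ∑ k, integralMul (Y 0 k) g * nodeMean Y x 0 k = exactIntegral g := by
    have hN' : (N : ℝ) ≠ 0 := by positivity
    simp only [nodeMean, Finset.mul_sum]
    rw [Finset.sum_comm]
    simp only [mul_left_comm _ (1 / (N : ℝ)), ← Finset.mul_sum, hY.sum_integralMul_mul_zero hd]
    simp [hN']
  have h3 := (hasSum_nat_add_iff' 1).2 h2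
  simpa [h0] using h3

theorem IsHarmonicSystem.sum_mul_nodeMean_sq (hd : 2 ≤ d) (hY : IsHarmonicSystem Y) {N : ℕ}
    (x : Fin N → Sph d) (a : ℕ → ℝ) (ℓ : ℕ) :
    ∑ k, a ℓ * |nodeMean Y x ℓ k| ^ 2 = 1 / (N : ℝ) ^ 2 * ∑ j, ∑ i,
      kernelTerm d a (inner ℝ (x j : EuclideanSpace ℝ (Fin (d + 1))) (x i)) ℓ := by
  have h (k) : a ℓ * |nodeMean Y x ℓ k| ^ 2 =
      ∑ j, ∑ i, a ℓ * (1 / (N : ℝ) ^ 2) * (Y ℓ k (x j) * Y ℓ k (x i)) := by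
    rw [sq_abs, nodeMean, mul_pow, sq (∑ j, _), Finset.sum_mul_sum]
    simp only [Finset.mul_sum]
    refine Finset.sum_congr rfl fun j _ => Finset.sum_congr rfl fun i _ => ?_
    ring
  simp only [h]
  rw [Finset.sum_comm, Finset.mul_sum]
  refine Finset.sum_congr rfl fun j _ => ?_
  rw [Finset.sum_comm, Finset.mul_sum]
  refine Finset.sum_congr rfl fun i _ => ?_
  rw [← Finset.mul_sum, hY.addition_theorem hd, kernelTerm]
  ring

theorem IsHarmonicSystem.hasSum_nodeMean_sq (hd : 2 ≤ d) (hY : IsHarmonicSystem Y) {a : ℕ → ℝ}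
    (ha : ∀ ℓ, 0 < a ℓ) (hsum : Summable fun ℓ : ℕ => a ℓ * harmonicDim d ℓ) {N : ℕ}
    (x : Fin N → Sph d) :
    HasSum (fun ℓ => ∑ k, a (ℓ + 1) * |nodeMean Y x (ℓ + 1) k| ^ 2)
      (1 / (N : ℝ) ^ 2 * ∑ j, ∑ i,
        calK d a (inner ℝ (x j : EuclideanSpace ℝ (Fin (d + 1))) (x i))) := by
  simp only [hY.sum_mul_nodeMean_sq hd]
  exact (hasSum_sum fun j _ => hasSum_sum fun i _ =>
    (hY.summable_kernelTerm hd ha hsum (innerFn_mem_Icc (x j) (x i))).hasSum).mul_left _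

theorem hasSum_sq_le_mul {u v w : ℕ → ℝ} {A B C : ℝ} (hu : HasSum u A) (hv : HasSum v B)
    (hw : HasSum w C) (hv0 : ∀ n, 0 ≤ v n) (hw0 : ∀ n, 0 ≤ w n) (h : ∀ n, u n ^ 2 ≤ v n * w n) :
    A ^ 2 ≤ B * C := by
  refine le_of_tendsto (hu.pow 2) (Filter.Eventually.of_forall fun s => ?_)
  refine (Finset.sum_sq_le_sum_mul_sum_of_sq_le_mul s (fun n _ => hv0 n) (fun n _ => hw0 n)
    fun n _ => h n).trans ?_
  exact mul_le_mul (sum_le_hasSum s (fun n _ => hv0 n) hv) (sum_le_hasSum s (fun n _ => hw0 n) hw)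
    (Finset.sum_nonneg fun n _ => hw0 n) (hv.nonneg hv0)

theorem IsHarmonicSystem.isGreatest_integrationErrors (hd : 2 ≤ d) (hY : IsHarmonicSystem Y)
    {s : ℝ} {a : ℕ → ℝ} (ha : ∀ ℓ, 0 < a ℓ)
    (hcomp : Comparable (fun ℓ => (1 + eigenvalue d ℓ) ^ (-s)) a)
    (hsum : Summable fun ℓ : ℕ => a ℓ * harmonicDim d ℓ) {N : ℕ} (hN : 0 < N)
    (x : Fin N → Sph d) {B : ℝ}
    (hB : HasSum (fun ℓ => ∑ k, a (ℓ + 1) * |nodeMean Y x (ℓ + 1) k| ^ 2) B) :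
    IsGreatest (integrationErrors x (sobolevContinuous Y s) fun g => sobolevNorm Y a (toL2 g))
      √B := by
  have hB0 : ∀ ℓ, 0 ≤ ∑ k, a (ℓ + 1) * |nodeMean Y x (ℓ + 1) k| ^ 2 := fun ℓ =>
    Finset.sum_nonneg fun k _ => mul_nonneg (ha _).le (sq_nonneg _)
  have hBn : 0 ≤ B := hB.nonneg hB0
  constructor
  -- The equality case of Cauchy-Schwarz, normalized. When `B = 0` division by zero gives `c = 0`,
  -- which attains the error `0`; so the squared norm is `B / B ≤ 1` in either case.
  · set c : (ℓ : ℕ) → Fin (harmonicDim d ℓ) → ℝ := fun ℓ k =>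
      if ℓ = 0 then 0 else a ℓ * nodeMean Y x ℓ k / √B with hc
    have hterm (ℓ) : ∑ k, 1 / a (ℓ + 1) * |c (ℓ + 1) k| ^ 2 =
        (∑ k, a (ℓ + 1) * |nodeMean Y x (ℓ + 1) k| ^ 2) / B := by
      rw [Finset.sum_div]
      refine Finset.sum_congr rfl fun k _ => ?_
      have := (ha (ℓ + 1)).ne'
      simp only [hc, Nat.add_one_ne_zero, if_false, sq_abs, div_pow, mul_pow, Real.sq_sqrt hBn]
      field_simp
    have hcs : HasSum (fun ℓ => ∑ k, 1 / a ℓ * |c ℓ k| ^ 2) (B / B) := by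
      rw [← hasSum_nat_add_iff' 1]
      simp only [hterm]
      simpa [hc] using hB.div_const B
    obtain ⟨g, hg, hgc⟩ := hY.exists_hasSum hd ha hsum c hcs.summable
    have hco : ∀ ℓ k, fourierCoeffSph Y (toL2 g) ℓ k = c ℓ k := fun ℓ k => by
      rw [fourierCoeffSph_toL2, hgc]
    refine ⟨g, (mem_sobolevSpace_iff hd ha hcomp).2 ?_, ?_, ?_⟩
    · simpa only [hco] using hcs.summable
    · simp only [sobolevNorm, hco, hcs.tsum_eq]
      exact Real.sqrt_le_one.2 (div_self_le_one B)
    · have he := hY.hasSum_error hd hN x (g := g) (by simpa only [hgc] using hg)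
      have he' : HasSum (fun ℓ => ∑ k, integralMul (Y (ℓ + 1) k) g * nodeMean Y x (ℓ + 1) k)
          (B / √B) := by
        refine (hB.div_const √B).congr_fun fun ℓ => ?_
        rw [Finset.sum_div]
        refine Finset.sum_congr rfl fun k _ => ?_
        simp only [hgc, hc, Nat.add_one_ne_zero, if_false, sq_abs]
        ring
      rw [he.unique he', Real.div_sqrt, abs_of_nonneg (Real.sqrt_nonneg B)]
  · rintro _ ⟨g, hg, hg1, rfl⟩
    have hgs := (mem_sobolevSpace_iff hd ha hcomp).1 hg
    obtain ⟨g', hg', hgsum⟩ := hY.hasSum_of_mem_sobolev hd ha hsum hgs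
    -- The sum of the series and `g` are continuous with the same class, so the expansion holds
    -- pointwise for `g` itself.
    obtain rfl := toL2_injective hg'
    simp only [fourierCoeffSph_toL2] at hgs hgsum
    have he := hY.hasSum_error hd hN x hgsum
    have hA0 : ∀ ℓ, 0 ≤ ∑ k, 1 / a ℓ * |integralMul (Y ℓ k) g'| ^ 2 := fun ℓ =>
      Finset.sum_nonneg fun k _ => mul_nonneg (one_div_pos.2 (ha _)).le (sq_nonneg _)
    have hA : ∑' ℓ, ∑ k, 1 / a ℓ * |integralMul (Y ℓ k) g'| ^ 2 ≤ 1 := by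
      simpa only [sobolevNorm, fourierCoeffSph_toL2, Real.sqrt_le_one] using hg1
    have hgs1 := (summable_nat_add_iff 1).2 hgs
    -- The error does not see degree zero, and dropping that nonnegative term only lowers the norm.
    have hA1 : ∑' ℓ, ∑ k, 1 / a (ℓ + 1) * |integralMul (Y (ℓ + 1) k) g'| ^ 2 ≤ 1 := by
      refine le_trans ?_ hA
      rw [hgs.tsum_eq_zero_add]
      linarith [hA0 0]
    have hCS := hasSum_sq_le_mul he hgs1.hasSum hB (fun ℓ => hA0 (ℓ + 1)) hB0 fun ℓ =>
      Finset.sum_sq_le_sum_mul_sum_of_sq_le_mul _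
        (fun k _ => mul_nonneg (one_div_pos.2 (ha _)).le (sq_nonneg _))
        (fun k _ => mul_nonneg (ha _).le (sq_nonneg _)) fun k _ => by
          have := (ha (ℓ + 1)).ne'
          refine le_of_eq ?_
          rw [sq_abs, sq_abs]
          field_simp
    refine Real.abs_le_sqrt (hCS.trans ?_)
    exact mul_le_of_le_one_left hBn hA1

end WorstCaseError

theorem proposition3p1 (d : ℕ) (hd : 2 ≤ d)
    (Y : (ℓ : ℕ) → Fin (harmonicDim d ℓ) → C(Sph d, ℝ)) (hY : IsHarmonicSystem Y)
    (s : ℝ) (hs : (d : ℝ) / 2 < s)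
    (a : ℕ → ℝ) (ha : ∀ ℓ, 0 < a ℓ)
    (hcomp : Comparable (fun ℓ => (1 + eigenvalue d ℓ) ^ (-s)) a)
    (N : ℕ) (hN : 0 < N) (x : Fin N → Sph d) :
    -- every element of `H^s` has exactly one continuous representative
    (∀ f ∈ sobolevSpace Y s, ∃! g : C(Sph d, ℝ), toL2 g = f) ∧
    -- the two series and the supremum below are finite
    (∀ t ∈ Set.Icc (-1 : ℝ) 1, Summable fun ℓ : ℕ => kernelTerm d a t (ℓ + 1)) ∧
    (Summable fun ℓ : ℕ =>
      ∑ k, a (ℓ + 1) * |1 / (N : ℝ) * ∑ j, Y (ℓ + 1) k (x j)| ^ 2) ∧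
    BddAbove (integrationErrors x (sobolevContinuous Y s) fun g => sobolevNorm Y a (toL2 g)) ∧
    -- the two expressions for the worst-case error
    0 ≤ 1 / (N : ℝ) ^ 2 * ∑ j, ∑ i,
        calK d a (inner ℝ (x j : EuclideanSpace ℝ (Fin (d + 1))) (x i)) ∧
    worstCaseError x (sobolevContinuous Y s) (fun g => sobolevNorm Y a (toL2 g)) =
      √(1 / (N : ℝ) ^ 2 * ∑ j, ∑ i,
        calK d a (inner ℝ (x j : EuclideanSpace ℝ (Fin (d + 1))) (x i))) ∧
    worstCaseError x (sobolevContinuous Y s) (fun g => sobolevNorm Y a (toL2 g)) =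
      √(∑' ℓ : ℕ, ∑ k, a (ℓ + 1) * |1 / (N : ℝ) * ∑ j, Y (ℓ + 1) k (x j)| ^ 2) := by
  have hsum := summable_mul_harmonicDim hd hs ha hcomp
  have hB := hY.hasSum_nodeMean_sq hd ha hsum x
  have hgr := hY.isGreatest_integrationErrors hd ha hcomp hsum hN x hB
  have hw : worstCaseError x (sobolevContinuous Y s) (fun g => sobolevNorm Y a (toL2 g)) =
      √(1 / (N : ℝ) ^ 2 * ∑ j, ∑ i,
        calK d a (inner ℝ (x j : EuclideanSpace ℝ (Fin (d + 1))) (x i))) := hgr.csSup_eq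
  refine ⟨fun f hf => ?_, fun t ht => hY.summable_kernelTerm hd ha hsum ht, hB.summable,
    ⟨_, hgr.2⟩, ?_, hw, ?_⟩
  · obtain ⟨g, hg, -⟩ := hY.hasSum_of_mem_sobolev hd ha hsum
      ((mem_sobolevSpace_iff hd ha hcomp).1 hf)
    exact ⟨g, hg, fun g' hg' => toL2_injective (hg'.trans hg.symm)⟩
  · exact hB.nonneg fun ℓ => Finset.sum_nonneg fun k _ => mul_nonneg (ha _).le (sq_nonneg _)
  · rw [hw, ← hB.tsum_eq]
    rfl
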